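/- Let $G$ be a finite group. Let $\mathscr{T}$ be the set of triples $(x,y,z)\in G^3$ with $xyz=1$ and $\langle x,y,z\rangle=G$, and let $\mathscr{T}/G$ be the set of orbits $[x,y,z]$ of $\mathscr{T}$ under simultaneous conjugation by elements of $G$. The group $\mathrm{Out}(G)$ acts on $\mathscr{T}/G$ coordinatewise, and the symmetric group $S_3$ acts on $\mathscr{T}/G$ in such a way that $(12)\cdot[x,y,z]=[y,x,x^{-1}zx]$ and $(13)\cdot[x,y,z]=[z,y,y^{-1}xy]$. These actions commute, and so define an action of $\mathrm{Out}(G)\times S_3$ on $\mathscr{T}/G$. Write $[x,y,z]\equiv[x',y',z']$ when $x$ is conjugate to $x'$, $y$ is conjugate to $y'$ and $z$ is conjugate to $z'$ in $G$ (possibly by different elements). Let $\mathcal{GT}_1(G)$ be the group of all permutations $\phi$ of $\mathscr{T}/G$ that commute with the action of $\mathrm{Out}(G)\times S_3$ and satisfy $\phi(t)\equiv t$ for all $t\in\mathscr{T}/G$. For a prime power $q$ let $\mathrm{PSL}(2,q)=\mathrm{SL}(2,\mathbb{F}_q)/Z(\mathrm{SL}(2,\mathbb{F}_q))$. (1) For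 every integer $s\ge 1$, the group $\mathcal{GT}_1(\mathrm{PSL}(2,2^s))$ is trivial. (2) For every odd prime power $q$, there are integers $n_1,n_2\ge 0$ such that $$\mathcal{GT}_1(\mathrm{PSL}(2,q))\cong C_2^{n_1}\times D_8^{n_2},$$ where $C_2$ is the cyclic group of order $2$ and $D_8$ is the dihedral group of order $8$. -/

import Mathlib

universe u

namespace GrothendieckTeichmuller

section Triples

variable (G : Type u) [Group G]

/-- Triples `(x, y, z)` of elements of `G` with `x y z = 1` that generate `G`. -/
@[ext]
structure Triple where
  x : G
  y : G
  z : G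
  mul_eq_one : x * y * z = 1
  closure_eq_top : Subgroup.closure ({x, y, z} : Set G) = ⊤

/-- The group `Out(G) = Aut(G) / Inn(G)` of outer automorphisms. -/
abbrev Out : Type u := MulAut G ⧸ (MulAut.conj : G →* MulAut G).range

variable {G}

instance normal_range_conj : (MulAut.conj : G →* MulAut G).range.Normal := by
  constructor
  rintro _ ⟨g, rfl⟩ a
  refine ⟨a g, ?_⟩
  ext h
  simp [MulAut.conj_apply]

/-- Automorphisms of `G` act on generating triples coordinatewise. -/
instance : MulAction (MulAut G) (Triple G) where
  smul a t :=
    { x := a t.x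
      y := a t.y
      z := a t.z
      mul_eq_one := by rw [← map_mul, ← map_mul, t.mul_eq_one, map_one]
      closure_eq_top := by
        have h := congrArg (Subgroup.map (a : G →* G)) t.closure_eq_top
        rw [MonoidHom.map_closure, Subgroup.map_top_of_surjective _ a.surjective] at h
        simpa [Set.image_insert_eq] using h }
  one_smul _ := rfl
  mul_smul _ _ _ := rfl

@[simp] theorem smul_x (a : MulAut G) (t : Triple G) : (a • t).x = a t.x := rfl
@[simp] theorem smul_y (a : MulAut G) (t : Triple G) : (a • t).y = a t.y := rfl
@[simp] theorem smul_z (a : MulAut G) (t : Triple G) : (a • t).z = a t.z := rfl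

variable (G) in
/-- Simultaneous conjugation of triples by an element of `G`. -/
instance Triple.setoid : Setoid (Triple G) where
  r t t' := ∃ g : G, MulAut.conj g • t = t'
  iseqv :=
    { refl := fun t => ⟨1, by simp⟩
      symm := by
        rintro t _ ⟨g, rfl⟩
        exact ⟨g⁻¹, by rw [map_inv, inv_smul_smul]⟩
      trans := by
        rintro t _ _ ⟨g, rfl⟩ ⟨h, rfl⟩
        exact ⟨h * g, by rw [map_mul, mul_smul]⟩ }

variable (G) in
/-- The set `𝒯/G` of classes `[x, y, z]` of generating triples under simultaneous conjugation. -/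
abbrev TripleClass : Type u := Quotient (Triple.setoid G)

theorem closure_triple_eq_top {x y z x' y' z' : G}
    (h : Subgroup.closure ({x, y, z} : Set G) = ⊤)
    (hx : x ∈ Subgroup.closure ({x', y', z'} : Set G))
    (hy : y ∈ Subgroup.closure ({x', y', z'} : Set G))
    (hz : z ∈ Subgroup.closure ({x', y', z'} : Set G)) :
    Subgroup.closure ({x', y', z'} : Set G) = ⊤ := by
  rw [eq_top_iff, ← h, Subgroup.closure_le]
  rintro w (rfl | rfl | rfl) <;> assumption

/-- `(x, y, z) ↦ (y, x, x⁻¹ z x)`. -/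
def Triple.theta (t : Triple G) : Triple G where
  x := t.y
  y := t.x
  z := t.x⁻¹ * t.z * t.x
  mul_eq_one := by
    have h := mul_eq_one_iff_eq_inv.1 t.mul_eq_one
    rw [← inv_eq_iff_eq_inv] at h
    rw [eq_comm, ← h]; group
  closure_eq_top := by
    have hx : t.x ∈ Subgroup.closure ({t.y, t.x, t.x⁻¹ * t.z * t.x} : Set G) :=
      Subgroup.subset_closure (by simp)
    refine closure_triple_eq_top t.closure_eq_top hx (Subgroup.subset_closure (by simp)) ?_
    have hz : t.x⁻¹ * t.z * t.x ∈ Subgroup.closure ({t.y, t.x, t.x⁻¹ * t.z * t.x} : Set G) :=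
      Subgroup.subset_closure (by simp)
    have := mul_mem (mul_mem hx hz) (inv_mem hx)
    simpa [mul_assoc] using this

/-- `(x, y, z) ↦ (z, y, y⁻¹ x y)`. -/
def Triple.delta (t : Triple G) : Triple G where
  x := t.z
  y := t.y
  z := t.y⁻¹ * t.x * t.y
  mul_eq_one := by
    have h := mul_eq_one_iff_eq_inv.1 t.mul_eq_one
    rw [← inv_eq_iff_eq_inv] at h
    rw [eq_comm, ← h]; group
  closure_eq_top := by
    have hy : t.y ∈ Subgroup.closure ({t.z, t.y, t.y⁻¹ * t.x * t.y} : Set G) :=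
      Subgroup.subset_closure (by simp)
    refine closure_triple_eq_top t.closure_eq_top ?_ hy (Subgroup.subset_closure (by simp))
    have hz : t.y⁻¹ * t.x * t.y ∈ Subgroup.closure ({t.z, t.y, t.y⁻¹ * t.x * t.y} : Set G) :=
      Subgroup.subset_closure (by simp)
    have := mul_mem (mul_mem hy hz) (inv_mem hy)
    simpa [mul_assoc] using this

theorem Triple.z_eq (t : Triple G) : t.z = t.y⁻¹ * t.x⁻¹ := by
  rw [← mul_inv_rev]; exact eq_inv_of_mul_eq_one_right t.mul_eq_one

theorem Triple.theta_theta (t : Triple G) : t.theta.theta = t := by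
  ext <;> simp [Triple.theta, Triple.z_eq, mul_assoc]

theorem Triple.delta_delta (t : Triple G) : t.delta.delta = MulAut.conj t.y⁻¹ • t := by
  ext <;> simp [Triple.delta, Triple.z_eq, mul_assoc]

theorem Triple.mk_delta_delta (t : Triple G) : (⟦t.delta.delta⟧ : TripleClass G) = ⟦t⟧ :=
  Quotient.sound (Setoid.symm ⟨t.y⁻¹, t.delta_delta.symm⟩)

theorem Triple.theta_smul (a : MulAut G) (t : Triple G) : (a • t).theta = a • t.theta := by
  ext <;> simp [Triple.theta]

theorem Triple.delta_smul (a : MulAut G) (t : Triple G) : (a • t).delta = a • t.delta := by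
  ext <;> simp [Triple.delta]

theorem Triple.theta_delta_cube (t : Triple G) :
    t.delta.theta.delta.theta.delta.theta = t := by
  ext <;> simp [Triple.delta, Triple.theta, Triple.z_eq, mul_assoc]

variable (G) in
/-- The permutation `θ · [x, y, z] = [y, x, z^x]` of `𝒯/G`, where `z^x = x⁻¹ z x`. -/
def theta : Equiv.Perm (TripleClass G) where
  toFun := Quotient.map Triple.theta (by
    rintro t _ ⟨g, rfl⟩
    exact ⟨g, (Triple.theta_smul _ t).symm⟩)
  invFun := Quotient.map Triple.theta (by
    rintro t _ ⟨g, rfl⟩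
    exact ⟨g, (Triple.theta_smul _ t).symm⟩)
  left_inv := by rintro ⟨t⟩; exact congrArg _ t.theta_theta
  right_inv := by rintro ⟨t⟩; exact congrArg _ t.theta_theta

variable (G) in
/-- The permutation `δ · [x, y, z] = [z, y, x^y]` of `𝒯/G`, where `x^y = y⁻¹ x y`. -/
def delta : Equiv.Perm (TripleClass G) where
  toFun := Quotient.map Triple.delta (by
    rintro t _ ⟨g, rfl⟩
    exact ⟨g, (Triple.delta_smul _ t).symm⟩)
  invFun := Quotient.map Triple.delta (by
    rintro t _ ⟨g, rfl⟩
    exact ⟨g, (Triple.delta_smul _ t).symm⟩)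
  left_inv := by rintro ⟨t⟩; exact Triple.mk_delta_delta t
  right_inv := by rintro ⟨t⟩; exact Triple.mk_delta_delta t

theorem theta_mk (t : Triple G) : theta G ⟦t⟧ = ⟦t.theta⟧ := rfl

theorem delta_mk (t : Triple G) : delta G ⟦t⟧ = ⟦t.delta⟧ := rfl

theorem theta_sq : theta G * theta G = 1 := by
  ext ⟨t⟩; exact congrArg _ t.theta_theta

theorem delta_sq : delta G * delta G = 1 := by
  ext ⟨t⟩; exact Triple.mk_delta_delta t

theorem theta_delta_cube :
    theta G * delta G * (theta G * delta G) * (theta G * delta G) = 1 := by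
  ext ⟨t⟩; exact congrArg _ t.theta_delta_cube

end Triples

section SymmetricGroup

variable {K : Type u} [Group K]

/-- The map `S₃ → K` sending `(12)`, `(13)` to `a`, `b`, and extended to the other elements
by `(23) = (12)(13)(12)` and by writing the two 3-cycles as products of `(12)` and `(13)`. -/
def symFun (a b : K) (σ : Equiv.Perm (Fin 3)) : K :=
  if σ = 1 then 1
  else if σ = Equiv.swap 0 1 then a
  else if σ = Equiv.swap 0 2 then b
  else if σ = Equiv.swap 1 2 then a * b * a
  else if σ = Equiv.swap 0 1 * Equiv.swap 0 2 then a * b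
  else b * a

/-- The homomorphism `S₃ → K` sending `(12)` to `a` and `(13)` to `b`. -/
def symHom (a b : K) (ha : a * a = 1) (hb : b * b = 1)
    (hab : a * b * (a * b) * (a * b) = 1) : Equiv.Perm (Fin 3) →* K where
  toFun := symFun a b
  map_one' := by simp [symFun]
  map_mul' := by
    have ha' : ∀ x, a * (a * x) = x := fun x => by rw [← mul_assoc, ha, one_mul]
    have hb' : ∀ x, b * (b * x) = x := fun x => by rw [← mul_assoc, hb, one_mul]
    have h1 : b * (a * b) = a * (b * a) := by
      have h : a * (b * (a * (b * (a * b)))) = 1 := by simpa only [mul_assoc] using hab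
      calc b * (a * b) = a * (b * (a * (a * (b * (a * (b * (a * b))))))) := by
            rw [ha', hb', ha']
        _ = a * (b * a) := by rw [h, mul_one]
    have h2 : ∀ x, b * (a * (b * x)) = a * (b * (a * x)) := fun x => by
      simpa only [mul_assoc] using congrArg (· * x) h1
    have key : ∀ σ : Equiv.Perm (Fin 3), σ = 1 ∨ σ = Equiv.swap 0 1 ∨ σ = Equiv.swap 0 2 ∨
        σ = Equiv.swap 1 2 ∨ σ = Equiv.swap 0 1 * Equiv.swap 0 2 ∨
        σ = Equiv.swap 0 2 * Equiv.swap 0 1 := by decide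
    have e1 : symFun a b 1 = 1 := by simp [symFun]
    have e2 : symFun a b (Equiv.swap 0 1) = a := by
      rw [symFun, if_neg (by decide), if_pos rfl]
    have e3 : symFun a b (Equiv.swap 0 2) = b := by
      rw [symFun, if_neg (by decide), if_neg (by decide), if_pos rfl]
    have e4 : symFun a b (Equiv.swap 1 2) = a * b * a := by
      rw [symFun, if_neg (by decide), if_neg (by decide), if_neg (by decide), if_pos rfl]
    have e5 : symFun a b (Equiv.swap 0 1 * Equiv.swap 0 2) = a * b := by
      rw [symFun, if_neg (by decide), if_neg (by decide), if_neg (by decide),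
        if_neg (by decide), if_pos rfl]
    have e6 : symFun a b (Equiv.swap 0 2 * Equiv.swap 0 1) = b * a := by
      rw [symFun, if_neg (by decide), if_neg (by decide), if_neg (by decide),
        if_neg (by decide), if_neg (by decide)]
    -- left multiplication by each of the two generators
    have l1 : ∀ τ, symFun a b (Equiv.swap 0 1 * τ) = a * symFun a b τ := by
      intro τ
      rcases key τ with rfl | rfl | rfl | rfl | rfl | rfl
      · rw [mul_one, e1, e2, mul_one]
      · rw [Equiv.swap_mul_self, e1, e2, ha]
      · rw [e5, e3]
      · rw [show (Equiv.swap 0 1 * Equiv.swap 1 2 : Equiv.Perm (Fin 3)) =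
          Equiv.swap 0 2 * Equiv.swap 0 1 by decide, e6, e4, mul_assoc a b a, ha']
      · rw [Equiv.swap_mul_self_mul, e3, e5, ha']
      · rw [show (Equiv.swap 0 1 * (Equiv.swap 0 2 * Equiv.swap 0 1) : Equiv.Perm (Fin 3)) =
          Equiv.swap 1 2 by decide, e4, e6, mul_assoc]
    have l2 : ∀ τ, symFun a b (Equiv.swap 0 2 * τ) = b * symFun a b τ := by
      intro τ
      rcases key τ with rfl | rfl | rfl | rfl | rfl | rfl
      · rw [mul_one, e1, e3, mul_one]
      · rw [e6, e2]
      · rw [Equiv.swap_mul_self, e1, e3, hb]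
      · rw [show (Equiv.swap 0 2 * Equiv.swap 1 2 : Equiv.Perm (Fin 3)) =
          Equiv.swap 0 1 * Equiv.swap 0 2 by decide, e5, e4, mul_assoc a b a, h2, ha, mul_one]
      · rw [show (Equiv.swap 0 2 * (Equiv.swap 0 1 * Equiv.swap 0 2) : Equiv.Perm (Fin 3)) =
          Equiv.swap 1 2 by decide, e4, e5, h1, mul_assoc]
      · rw [Equiv.swap_mul_self_mul, e2, e6, hb']
    intro σ τ
    rcases key σ with rfl | rfl | rfl | rfl | rfl | rfl
    · rw [one_mul, e1, one_mul]
    · rw [l1, e2]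
    · rw [l2, e3]
    · rw [show (Equiv.swap 1 2 : Equiv.Perm (Fin 3)) =
        Equiv.swap 0 1 * (Equiv.swap 0 2 * Equiv.swap 0 1) by decide]
      simp only [mul_assoc, l1, l2, e2]
    · simp only [mul_assoc, l1, l2, e3]
    · simp only [mul_assoc, l1, l2, e2]

theorem symHom_swap_zero_one (a b : K) (ha : a * a = 1) (hb : b * b = 1)
    (hab : a * b * (a * b) * (a * b) = 1) :
    symHom a b ha hb hab (Equiv.swap 0 1) = a := by
  change symFun a b (Equiv.swap 0 1) = a
  rw [symFun, if_neg (by decide), if_pos rfl]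

theorem symHom_swap_zero_two (a b : K) (ha : a * a = 1) (hb : b * b = 1)
    (hab : a * b * (a * b) * (a * b) = 1) :
    symHom a b ha hb hab (Equiv.swap 0 2) = b := by
  change symFun a b (Equiv.swap 0 2) = b
  rw [symFun, if_neg (by decide), if_neg (by decide), if_pos rfl]

end SymmetricGroup

section Action

variable (G : Type u) [Group G]

/-- The action of `S₃` on `𝒯/G`, where `(12)` acts as `θ` and `(13)` acts as `δ`. -/
def symAction : Equiv.Perm (Fin 3) →* Equiv.Perm (TripleClass G) :=
  symHom (theta G) (delta G) theta_sq delta_sq theta_delta_cube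

theorem symAction_swap_zero_one : symAction G (Equiv.swap 0 1) = theta G :=
  symHom_swap_zero_one _ _ _ _ _

theorem symAction_swap_zero_two : symAction G (Equiv.swap 0 2) = delta G :=
  symHom_swap_zero_two _ _ _ _ _

/-- The action of `Aut(G)` on `𝒯/G`: `a · [x, y, z] = [a x, a y, a z]`. -/
def autAction : MulAut G →* Equiv.Perm (TripleClass G) :=
  MonoidHom.toHomPerm
    { toFun := fun a => Quotient.map (a • ·) (by
        rintro t _ ⟨g, rfl⟩
        refine ⟨a g, ?_⟩
        ext <;> simp [MulAut.conj_apply])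
      map_one' := by
        funext c
        induction c using Quotient.inductionOn with
        | h t => exact congrArg (Quotient.mk _) (one_smul _ t)
      map_mul' := fun a b => by
        funext c
        induction c using Quotient.inductionOn with
        | h t => exact congrArg (Quotient.mk _) (mul_smul a b t) }

theorem autAction_mk (a : MulAut G) (t : Triple G) : autAction G a ⟦t⟧ = ⟦a • t⟧ := rfl

/-- The induced action of `Out(G)` on `𝒯/G`. -/
def outAction : Out G →* Equiv.Perm (TripleClass G) :=
  QuotientGroup.lift _ (autAction G) (by
    rintro _ ⟨g, rfl⟩
    ext ⟨t⟩
    exact (Quotient.sound ⟨g, rfl⟩ : (⟦t⟧ : TripleClass G) = ⟦MulAut.conj g • t⟧).symm)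

theorem outAction_mk (a : MulAut G) (t : Triple G) :
    outAction G (QuotientGroup.mk a) ⟦t⟧ = ⟦a • t⟧ := rfl

theorem outAction_commute_theta (o : Out G) : Commute (outAction G o) (theta G) := by
  induction o using QuotientGroup.induction_on with
  | H a =>
    ext ⟨t⟩
    exact congrArg (Quotient.mk _) (Triple.theta_smul a t).symm

theorem outAction_commute_delta (o : Out G) : Commute (outAction G o) (delta G) := by
  induction o using QuotientGroup.induction_on with
  | H a =>
    ext ⟨t⟩
    exact congrArg (Quotient.mk _) (Triple.delta_smul a t).symm

theorem outAction_commute_symAction (o : Out G) (σ : Equiv.Perm (Fin 3)) :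
    Commute (outAction G o) (symAction G σ) := by
  have h1 := outAction_commute_theta G o
  have h2 := outAction_commute_delta G o
  change Commute _ (symFun _ _ σ)
  unfold symFun
  split_ifs
  · exact Commute.one_right _
  · exact h1
  · exact h2
  · exact (h1.mul_right h2).mul_right h1
  · exact h1.mul_right h2
  · exact h2.mul_right h1

/-- The action of `H = Out(G) × S₃` on `𝒯/G`. -/
def hAction : Out G × Equiv.Perm (Fin 3) →* Equiv.Perm (TripleClass G) :=
  MonoidHom.noncommCoprod (outAction G) (symAction G) (outAction_commute_symAction G)

variable {G}

theorem isConj_smul (g x : G) : IsConj x (MulAut.conj g x) :=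
  isConj_iff.2 ⟨g, rfl⟩

/-- Coordinatewise conjugacy `[x, y, z] ≡ [x', y', z']`: `x` is conjugate to `x'`,
`y` to `y'` and `z` to `z'`, possibly through different elements of `G`. -/
def CoordConj (c c' : TripleClass G) : Prop :=
  Quotient.liftOn₂ c c' (fun t t' => IsConj t.x t'.x ∧ IsConj t.y t'.y ∧ IsConj t.z t'.z) (by
    rintro t t' _ _ ⟨g, rfl⟩ ⟨h, rfl⟩
    have aux : ∀ w w' : G, IsConj w w' ↔ IsConj (MulAut.conj g w) (MulAut.conj h w') :=
      fun w w' => ⟨fun k => ((isConj_smul g w).symm.trans k).trans (isConj_smul h w'),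
        fun k => ((isConj_smul g w).trans k).trans (isConj_smul h w').symm⟩
    exact propext (and_congr (aux _ _) (and_congr (aux _ _) (aux _ _))))

theorem CoordConj.refl (c : TripleClass G) : CoordConj c c := by
  induction c using Quotient.inductionOn with
  | h t => exact ⟨IsConj.refl _, IsConj.refl _, IsConj.refl _⟩

theorem CoordConj.symm {c c' : TripleClass G} (h : CoordConj c c') : CoordConj c' c := by
  induction c using Quotient.inductionOn with
  | h t =>
    induction c' using Quotient.inductionOn with
    | h t' => exact ⟨h.1.symm, h.2.1.symm, h.2.2.symm⟩

theorem CoordConj.trans {c c' c'' : TripleClass G} (h : CoordConj c c')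
    (h' : CoordConj c' c'') : CoordConj c c'' := by
  induction c using Quotient.inductionOn with
  | h t =>
    induction c' using Quotient.inductionOn with
    | h t' =>
      induction c'' using Quotient.inductionOn with
      | h t'' => exact ⟨h.1.trans h'.1, h.2.1.trans h'.2.1, h.2.2.trans h'.2.2⟩

variable (G)

/-- The group `𝒢𝒯₁(G)` of the permutations of `𝒯/G` that commute with the action of
`H = Out(G) × S₃` and map every class `t` to a class coordinatewise conjugate to `t`. -/
def GT₁ : Subgroup (Equiv.Perm (TripleClass G)) where
  carrier := {φ | (∀ (h : Out G × Equiv.Perm (Fin 3)) (t : TripleClass G),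
      φ (hAction G h t) = hAction G h (φ t)) ∧ ∀ t : TripleClass G, CoordConj t (φ t)}
  one_mem' := ⟨fun _ _ => rfl, fun t => CoordConj.refl t⟩
  mul_mem' := by
    rintro φ ψ ⟨h1, h2⟩ ⟨k1, k2⟩
    refine ⟨fun h t => ?_, fun t => (k2 t).trans (h2 (ψ t))⟩
    rw [Equiv.Perm.mul_apply, Equiv.Perm.mul_apply, k1, h1]
  inv_mem' := by
    rintro φ ⟨h1, h2⟩
    refine ⟨fun h t => ?_, fun t => ?_⟩
    · rw [Equiv.Perm.inv_eq_iff_eq, h1, Equiv.Perm.coe_inv, Equiv.apply_symm_apply]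
    · have := h2 (φ⁻¹ t)
      rw [Equiv.Perm.coe_inv, Equiv.apply_symm_apply] at this
      exact this.symm

end Action

end GrothendieckTeichmuller

/-! A generating triple of PSL(2,F) is given by lifts A, B in SL(2,F), which generate the full
matrix algebra. Such a pair is determined up to GL(2,F)-conjugacy by tr A, tr B and tr AB
(`exists_intertwiner`). Coordinatewise conjugacy fixes these traces up to sign. The signs of A and B
can be absorbed in the lifts, so only the sign of tr AB remains free. GL(2,F)-conjugacy differs from
PSL-conjugacy by the class of a determinant modulo squares. In characteristic 2 both ambiguities
vanish: coordinatewise conjugate classes are equal and the group is trivial.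

For q odd, let d be conjugation by diag(ν, 1) with ν a nonsquare. It acts on the triple classes as
an involution without fixed points, and every ≡-class meets at most two d-orbits, hence has at most
four elements (`eq_or_of_coordConj`). A permutation that commutes with H = Out(G) × S₃ and preserves
the ≡-classes amounts to an independent choice, for one ≡-class in each H-orbit of them, of a
permutation commuting with the stabilizer of that ≡-class (`nonempty_equivariant_mulEquiv_pi`).

Each local factor has exponent dividing 2 or is D₈ (`equivariantOn_dichotomy`). If some ψ in it is
not an involution, then d preserves the ≡-class and ψ is a 4-cycle on it with ψ² = d. Every
stabilizing element of H commutes with ψ, so acts as a power of ψ. An odd power would make d a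
square modulo inner automorphisms, which is impossible because d exchanges the two classes of
elements of order p (`not_square_diagAut`). So the stabilizer acts through 1 and d, and the local
factor is the full centralizer of d in S₄, namely D₈. Simplicity of PSL(2,q) plays no role, so small
q need no separate treatment. -/

/-! ### Pairs of 2 × 2 matrices and their traces -/

/-- The relations reduce every word in a and b to the span of 1, a, b, ab. The ring R is left
general so that this applies to pairs of matrices in a product algebra. -/
theorem Algebra.finrank_adjoin_pair_le {F R : Type*} [Field F] [Ring R] [Algebra F R]
    {a b : R} {α β c : F} (ha : a * a = α • a - 1) (hb : b * b = β • b - 1)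
    (hba : b * a = α • b + β • a + c • 1 - a * b) :
    FiniteDimensional F (Algebra.adjoin F {a, b}) ∧
      Module.finrank F (Algebra.adjoin F {a, b}) ≤ 4 := by
  classical
  set S : Submodule F R := Submodule.span F (({1, a, b, a * b} : Finset R) : Set R) with hS
  have m1 : (1 : R) ∈ S := Submodule.subset_span (by simp)
  have ma : a ∈ S := Submodule.subset_span (by simp)
  have mb : b ∈ S := Submodule.subset_span (by simp)
  have mab : a * b ∈ S := Submodule.subset_span (by simp)
  -- The span is stable under right multiplication by the algebra; since it contains 1, it contains
  -- the algebra.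
  have closed : ∀ x ∈ Algebra.adjoin F {a, b}, ∀ s ∈ S, s * x ∈ S := by
    intro x hx
    induction hx using Algebra.adjoin_induction with
    | mem x hx =>
      intro s hs
      refine Submodule.span_induction (p := fun s _ => s * x ∈ S) ?_ (by simp)
        (fun u v _ _ hu hv => by rw [add_mul]; exact add_mem hu hv)
        (fun c u _ hu => by rw [smul_mul_assoc]; exact S.smul_mem _ hu) hs
      intro s hs
      simp only [Finset.coe_insert, Finset.coe_singleton, Set.mem_insert_iff,
        Set.mem_singleton_iff] at hs hx
      rcases hx with rfl | rfl
      · rcases hs with rfl | rfl | rfl | rfl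
        · simpa using ma
        · rw [ha]; exact sub_mem (S.smul_mem _ ma) m1
        · rw [hba]
          exact sub_mem (add_mem (add_mem (S.smul_mem _ mb) (S.smul_mem _ ma)) (S.smul_mem _ m1)) mab
        · have : x * b * x = α • (x * b) + β • (α • x - 1) + c • x - (α • (x * b) - b) := by
            rw [mul_assoc, hba, mul_sub, mul_add, mul_add, mul_smul_comm, mul_smul_comm,
              mul_smul_comm, mul_one, ha, ← mul_assoc, ha, sub_mul, smul_mul_assoc, one_mul]
          rw [this]
          exact sub_mem (add_mem (add_mem (S.smul_mem _ mab)
            (S.smul_mem _ (sub_mem (S.smul_mem _ ma) m1))) (S.smul_mem _ ma))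
            (sub_mem (S.smul_mem _ mab) mb)
      · rcases hs with rfl | rfl | rfl | rfl
        · simpa using mb
        · exact mab
        · rw [hb]; exact sub_mem (S.smul_mem _ mb) m1
        · rw [mul_assoc, hb, mul_sub, mul_smul_comm, mul_one]
          exact sub_mem (S.smul_mem _ mab) ma
    | algebraMap r =>
      intro s hs
      rw [← Algebra.commutes, ← Algebra.smul_def]
      exact S.smul_mem _ hs
    | add x y _ _ hx hy =>
      intro s hs
      rw [mul_add]
      exact add_mem (hx s hs) (hy s hs)
    | mul x y _ _ hx hy =>
      intro s hs
      rw [← mul_assoc]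
      exact hy _ (hx s hs)
  have hle : Subalgebra.toSubmodule (Algebra.adjoin F {a, b}) ≤ S := fun x hx => by
    simpa using closed x hx 1 m1
  have : FiniteDimensional F S := FiniteDimensional.span_finset F _
  refine ⟨Submodule.finiteDimensional_of_le hle, (Submodule.finrank_mono hle).trans ?_⟩
  exact (finrank_span_finset_le_card _).trans Finset.card_le_four

namespace Matrix

section Pairs

variable {F : Type*} [Field F]

theorem mul_self_eq_of_det_eq_one {A : Matrix (Fin 2) (Fin 2) F} (hA : A.det = 1) :
    A * A = A.trace • A - 1 := by
  rw [det_fin_two] at hA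
  ext i j
  fin_cases i <;> fin_cases j <;>
    simp [mul_apply, Fin.sum_univ_two, trace_fin_two] <;> first | ring1 | linear_combination -hA

/-- The polarized Cayley–Hamilton identity; its coefficients involve only the three traces. -/
theorem mul_swap_fin_two (A B : Matrix (Fin 2) (Fin 2) F) :
    B * A = A.trace • B + B.trace • A + ((A * B).trace - A.trace * B.trace) • 1 - A * B := by
  ext i j
  fin_cases i <;> fin_cases j <;>
    simp [mul_apply, Fin.sum_univ_two, trace_fin_two] <;> ring

/-- Two pairs of matrices of determinant one with the same traces are conjugate when the
first generates the full matrix algebra. -/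
theorem exists_intertwiner {A B A' B' : Matrix (Fin 2) (Fin 2) F}
    (hA : A.det = 1) (hB : B.det = 1) (hA' : A'.det = 1) (hB' : B'.det = 1)
    (tA : A.trace = A'.trace) (tB : B.trace = B'.trace) (tAB : (A * B).trace = (A' * B').trace)
    (htop : Algebra.adjoin F {A, B} = ⊤) :
    ∃ P : Matrix (Fin 2) (Fin 2) F, P.det ≠ 0 ∧ P * A = A' * P ∧ P * B = B' * P := by
  let M := Matrix (Fin 2) (Fin 2) F
  let a : M × M := (A, A')
  let b : M × M := (B, B')
  -- Equal traces mean that (A, A') and (B, B') satisfy the same relations in M × M, so they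
  -- generate a subalgebra of dimension at most 4. It surjects onto the first factor, hence is the
  -- graph of an algebra endomorphism of M.
  obtain ⟨hfin, hrank⟩ := Algebra.finrank_adjoin_pair_le (F := F) (a := a) (b := b)
    (α := A.trace) (β := B.trace) (c := (A * B).trace - A.trace * B.trace)
    (Prod.ext (mul_self_eq_of_det_eq_one hA) (by
      rw [tA]; exact mul_self_eq_of_det_eq_one hA'))
    (Prod.ext (mul_self_eq_of_det_eq_one hB) (by
      rw [tB]; exact mul_self_eq_of_det_eq_one hB'))
    (Prod.ext (mul_swap_fin_two A B) (by
      rw [tA, tB, tAB]; exact mul_swap_fin_two A' B'))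
  let S := Algebra.adjoin F {a, b}
  let p : S →ₐ[F] M := (AlgHom.fst F M M).comp S.val
  let p' : S →ₐ[F] M := (AlgHom.snd F M M).comp S.val
  have hsurj : Function.Surjective p := by
    rw [← AlgHom.range_eq_top, AlgHom.range_comp, Subalgebra.range_val, AlgHom.map_adjoin,
      Set.image_pair]
    exact htop
  have hM : Module.finrank F M = 4 := by
    simp [M, Module.finrank_matrix]
  have hS : Module.finrank F S = Module.finrank F M := by
    refine le_antisymm (hrank.trans hM.ge) ?_
    exact LinearMap.finrank_le_finrank_of_surjective (f := p.toLinearMap) hsurj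
  have hinj : Function.Injective p :=
    (LinearMap.injective_iff_surjective_of_finrank_eq_finrank (f := p.toLinearMap) hS).2 hsurj
  let e : S ≃ₐ[F] M := AlgEquiv.ofBijective p ⟨hinj, hsurj⟩
  let f : M →ₐ[F] M := p'.comp e.symm.toAlgHom
  have hf : Function.Injective f := RingHom.injective f.toRingHom
  let g : M ≃ₐ[F] M := AlgEquiv.ofBijective f
    ⟨hf, (LinearMap.injective_iff_surjective (f := f.toLinearMap)).1 hf⟩
  have gval : ∀ s : S, g (p s) = p' s := fun s => by
    change p' (e.symm (e s)) = _
    rw [e.symm_apply_apply]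
  have gA : g A = A' := gval ⟨a, Algebra.subset_adjoin (by simp)⟩
  have gB : g B = B' := gval ⟨b, Algebra.subset_adjoin (by simp)⟩
  let L : M ≃ₐ[F] Module.End F (Fin 2 → F) := toLinAlgEquiv'
  -- Skolem–Noether: the automorphism is inner, and the matrix of T is the intertwiner.
  obtain ⟨T, hT⟩ := AlgEquiv.eq_linearEquivConjAlgEquiv (L.symm.trans (g.trans L))
  have key : ∀ X : M, LinearMap.toMatrix' T.toLinearMap * X =
      g X * LinearMap.toMatrix' T.toLinearMap := by
    intro X
    have h := congrArg (fun φ => φ (L X)) hT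
    simp only [AlgEquiv.trans_apply, AlgEquiv.symm_apply_apply] at h
    have h2 : T.toLinearMap ∘ₗ (toLin' X) = (toLin' (g X)) ∘ₗ T.toLinearMap := by
      have h3 : toLin' (g X) = T.conjAlgEquiv F (toLin' X) := h
      rw [h3]
      ext v
      simp [LinearEquiv.conjAlgEquiv_apply]
    have h4 := congrArg LinearMap.toMatrix' h2
    simpa only [LinearMap.toMatrix'_comp, LinearMap.toMatrix'_toLin'] using h4
  refine ⟨LinearMap.toMatrix' T.toLinearMap, ?_, ?_, ?_⟩
  · rw [LinearMap.det_toMatrix']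
    exact (LinearEquiv.isUnit_det' T).ne_zero
  · rw [key, gA]
  · rw [key, gB]

theorem inv_eq_trace_sub (g : SpecialLinearGroup (Fin 2) F) :
    ((g⁻¹ : SpecialLinearGroup (Fin 2) F) : Matrix (Fin 2) (Fin 2) F) =
      (g : Matrix (Fin 2) (Fin 2) F).trace • 1 - (g : Matrix (Fin 2) (Fin 2) F) := by
  rw [SpecialLinearGroup.coe_inv, adjugate_fin_two]
  ext i j
  fin_cases i <;> fin_cases j <;> simp [trace_fin_two]

namespace SpecialLinearGroup

theorem trace_coe_inv (g : SpecialLinearGroup (Fin 2) F) :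
    ((g⁻¹ : SpecialLinearGroup (Fin 2) F) : Matrix (Fin 2) (Fin 2) F).trace =
      (g : Matrix (Fin 2) (Fin 2) F).trace := by
  rw [coe_inv, adjugate_fin_two]
  simp [trace_fin_two, add_comm]

/-- The upper unitriangular matrix with off-diagonal entry `b`. -/
def upper (b : F) : SpecialLinearGroup (Fin 2) F := ⟨!![1, b; 0, 1], by simp⟩

/-- The lower unitriangular matrix with off-diagonal entry `b`. -/
def lower (b : F) : SpecialLinearGroup (Fin 2) F := ⟨!![1, 0; b, 1], by simp⟩

/-- Subtracting 1 from the elementary unipotents gives the off-diagonal matrix units, whose products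
are the diagonal ones. -/
theorem subalgebra_eq_top (S : Subalgebra F (Matrix (Fin 2) (Fin 2) F))
    (h : ∀ g : SpecialLinearGroup (Fin 2) F, (g : Matrix (Fin 2) (Fin 2) F) ∈ S) : S = ⊤ := by
  have hu : (!![0, 1; 0, 0] : Matrix (Fin 2) (Fin 2) F) ∈ S := by
    have := sub_mem (h (upper 1)) S.one_mem
    convert this using 1
    ext i j; fin_cases i <;> fin_cases j <;> simp [upper]
  have hl : (!![0, 0; 1, 0] : Matrix (Fin 2) (Fin 2) F) ∈ S := by
    have := sub_mem (h (lower 1)) S.one_mem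
    convert this using 1
    ext i j; fin_cases i <;> fin_cases j <;> simp [lower]
  refine eq_top_iff.2 fun M _ => ?_
  have := add_mem (add_mem (S.smul_mem (mul_mem hu hl) (M 0 0)) (S.smul_mem hu (M 0 1)))
    (add_mem (S.smul_mem hl (M 1 0)) (S.smul_mem (mul_mem hl hu) (M 1 1)))
  convert this using 1
  ext i j; fin_cases i <;> fin_cases j <;> simp

theorem mem_center_fin_two {A : SpecialLinearGroup (Fin 2) F} :
    A ∈ Subgroup.center (SpecialLinearGroup (Fin 2) F) ↔ A = 1 ∨ A = -1 := by
  rw [mem_center_iff]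
  constructor
  · rintro ⟨r, hr, h⟩
    rw [Fintype.card_fin, sq_eq_one_iff] at hr
    rcases hr with rfl | rfl
    · left; ext i j; rw [← h]; simp
    · right
      ext i j
      rw [← h]
      fin_cases i <;> fin_cases j <;> simp
  · rintro (rfl | rfl)
    · exact ⟨1, by simp, by simp⟩
    · refine ⟨-1, by simp, ?_⟩
      ext i j
      fin_cases i <;> fin_cases j <;> simp

end SpecialLinearGroup

/-! ### Lifting from PSL(2, F) to SL(2, F) -/

namespace ProjectiveSpecialLinearGroup

/-- The projection of `SL(2, F)` onto `PSL(2, F)`. -/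
def proj : SpecialLinearGroup (Fin 2) F →* ProjectiveSpecialLinearGroup (Fin 2) F :=
  QuotientGroup.mk' _

theorem proj_surjective : Function.Surjective (proj (F := F)) :=
  QuotientGroup.mk'_surjective _

theorem proj_eq_proj_iff {A B : SpecialLinearGroup (Fin 2) F} :
    proj A = proj B ↔ A = B ∨ A = -B := by
  rw [eq_comm, MonoidHom.eq_iff, proj, QuotientGroup.ker_mk', SpecialLinearGroup.mem_center_fin_two,
    inv_mul_eq_one, inv_mul_eq_iff_eq_mul, mul_neg, mul_one]
  constructor <;> rintro (rfl | rfl) <;> simp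

theorem proj_neg (A : SpecialLinearGroup (Fin 2) F) : proj (-A) = proj A :=
  proj_eq_proj_iff.2 (Or.inr rfl)

theorem trace_of_isConj {A A' : SpecialLinearGroup (Fin 2) F} (h : IsConj (proj A) (proj A')) :
    (A' : Matrix (Fin 2) (Fin 2) F).trace = (A : Matrix (Fin 2) (Fin 2) F).trace ∨
    (A' : Matrix (Fin 2) (Fin 2) F).trace = -(A : Matrix (Fin 2) (Fin 2) F).trace := by
  obtain ⟨c, hc⟩ := isConj_iff.1 h
  obtain ⟨C, rfl⟩ := proj_surjective c
  have tr : ((C * A * C⁻¹ : SpecialLinearGroup (Fin 2) F) : Matrix (Fin 2) (Fin 2) F).trace =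
      (A : Matrix (Fin 2) (Fin 2) F).trace := by
    rw [SpecialLinearGroup.coe_mul, trace_mul_comm, ← SpecialLinearGroup.coe_mul]
    simp
  rw [← map_inv, ← map_mul, ← map_mul, proj_eq_proj_iff] at hc
  rcases hc with hc | hc
  · left; rw [← hc, tr]
  · right; rw [← tr, hc]; simp

/-- As g⁻¹ = (tr g) · 1 − g, the elements of SL(2,F) lying in the subalgebra form a subgroup. It
surjects onto PSL(2,F), and signs do not matter in a subalgebra. -/
theorem adjoin_eq_top {A B : SpecialLinearGroup (Fin 2) F}
    (h : Subgroup.closure {proj A, proj B} = ⊤) :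
    Algebra.adjoin F {(A : Matrix (Fin 2) (Fin 2) F), (B : Matrix (Fin 2) (Fin 2) F)} = ⊤ := by
  set S := Algebra.adjoin F {(A : Matrix (Fin 2) (Fin 2) F), (B : Matrix (Fin 2) (Fin 2) F)}
  let K : Subgroup (SpecialLinearGroup (Fin 2) F) :=
    { carrier := {g | (g : Matrix (Fin 2) (Fin 2) F) ∈ S}
      one_mem' := S.one_mem
      mul_mem' := fun {g h} hg hh => by
        simpa using mul_mem hg hh
      inv_mem' := fun {g} hg => by
        change ((g⁻¹ : SpecialLinearGroup (Fin 2) F) : Matrix (Fin 2) (Fin 2) F) ∈ S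
        rw [inv_eq_trace_sub]
        exact sub_mem (S.smul_mem S.one_mem _) hg }
  have hA : A ∈ K := Algebra.subset_adjoin (by simp)
  have hB : B ∈ K := Algebra.subset_adjoin (by simp)
  have hmap : K.map proj = ⊤ := by
    rw [eq_top_iff, ← h, Subgroup.closure_le]
    rintro w (rfl | rfl)
    · exact ⟨A, hA, rfl⟩
    · exact ⟨B, hB, rfl⟩
  refine SpecialLinearGroup.subalgebra_eq_top S fun g => ?_
  have hg : proj g ∈ K.map proj := hmap ▸ Subgroup.mem_top _
  obtain ⟨k, hk, hkg⟩ := hg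
  rcases proj_eq_proj_iff.1 hkg with rfl | rfl
  · exact hk
  · have : ((-g : SpecialLinearGroup (Fin 2) F) : Matrix (Fin 2) (Fin 2) F) ∈ S := hk
    simpa using this

end ProjectiveSpecialLinearGroup

end Pairs

end Matrix

/-! ### The diagonal automorphism and unipotent elements -/

namespace Matrix

namespace SpecialLinearGroup

variable {F : Type*} [Field F]

theorem coe_upper (b : F) :
    (upper b : Matrix (Fin 2) (Fin 2) F) = !![1, b; 0, 1] := rfl

/-- The diagonal matrix `(a, a⁻¹)`. -/
def torus (a : Fˣ) : SpecialLinearGroup (Fin 2) F := ⟨!![(a : F), 0; 0, (a⁻¹ : Fˣ)], by simp⟩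

theorem coe_torus (a : Fˣ) :
    (torus a : Matrix (Fin 2) (Fin 2) F) = !![(a : F), 0; 0, (a⁻¹ : Fˣ)] := rfl

/-- Conjugation by the diagonal matrix `(ν, 1)`. -/
def diagConjFun (ν : Fˣ) (A : SpecialLinearGroup (Fin 2) F) : SpecialLinearGroup (Fin 2) F :=
  ⟨!![A 0 0, ν * A 0 1; (ν⁻¹ : Fˣ) * A 1 0, A 1 1], by
    have := A.det_coe
    rw [det_fin_two] at this
    simp [det_fin_two, ← this]
    field_simp⟩

theorem coe_diagConjFun (ν : Fˣ) (A : SpecialLinearGroup (Fin 2) F) :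
    (diagConjFun ν A : Matrix (Fin 2) (Fin 2) F) =
      !![A 0 0, ν * A 0 1; (ν⁻¹ : Fˣ) * A 1 0, A 1 1] := rfl

theorem diagConjFun_inv_diagConjFun (ν : Fˣ) (A : SpecialLinearGroup (Fin 2) F) :
    diagConjFun ν⁻¹ (diagConjFun ν A) = A := by
  apply Subtype.ext
  rw [coe_diagConjFun, coe_diagConjFun]
  ext i j
  fin_cases i <;> fin_cases j <;> simp

/-- The automorphism of `SL(2, F)` given by conjugation by the diagonal matrix `(ν, 1)`. -/
def diagConj (ν : Fˣ) : MulAut (SpecialLinearGroup (Fin 2) F) where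
  toFun := diagConjFun ν
  invFun := diagConjFun ν⁻¹
  left_inv A := diagConjFun_inv_diagConjFun ν A
  right_inv A := by simpa using diagConjFun_inv_diagConjFun ν⁻¹ A
  map_mul' A B := by
    apply Subtype.ext
    rw [coe_mul, coe_diagConjFun, coe_diagConjFun, coe_diagConjFun]
    ext i j
    fin_cases i <;> fin_cases j <;> simp [mul_apply, Fin.sum_univ_two] <;> field_simp

theorem coe_diagConj (ν : Fˣ) (A : SpecialLinearGroup (Fin 2) F) :
    (diagConj ν A : Matrix (Fin 2) (Fin 2) F) =
      !![A 0 0, ν * A 0 1; (ν⁻¹ : Fˣ) * A 1 0, A 1 1] := rfl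

theorem diagConj_mul_diag (ν : Fˣ) (A : SpecialLinearGroup (Fin 2) F) :
    !![((ν⁻¹ : Fˣ) : F), 0; 0, 1] * (diagConj ν A : Matrix (Fin 2) (Fin 2) F) =
      (A : Matrix (Fin 2) (Fin 2) F) * !![((ν⁻¹ : Fˣ) : F), 0; 0, 1] := by
  rw [coe_diagConj]
  ext i j
  fin_cases i <;> fin_cases j <;> simp [mul_apply, Fin.sum_univ_two, mul_comm]

theorem diagConj_upper (ν : Fˣ) (b : F) : diagConj ν (upper b) = upper (ν * b) := by
  apply Subtype.ext
  rw [coe_diagConj, coe_upper, coe_upper]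
  simp

theorem diagConj_diagConj (ν : Fˣ) (A : SpecialLinearGroup (Fin 2) F) :
    diagConj ν (diagConj ν A) = torus ν * A * (torus ν)⁻¹ := by
  rw [eq_mul_inv_iff_mul_eq]
  apply Subtype.ext
  rw [coe_mul, coe_mul, coe_torus, coe_diagConj, coe_diagConj]
  ext i j
  fin_cases i <;> fin_cases j <;>
    simp [mul_apply, Fin.sum_univ_two] <;> field_simp

theorem torus_mul_upper (a : Fˣ) (b : F) :
    torus a * upper b = upper (a * a * b) * torus a := by
  apply Subtype.ext
  rw [coe_mul, coe_mul, coe_torus, coe_upper, coe_upper]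
  ext i j
  fin_cases i <;> fin_cases j <;> simp [mul_apply, Fin.sum_univ_two]
  field_simp

theorem upper_zero : (upper 0 : SpecialLinearGroup (Fin 2) F) = 1 := by
  ext i j
  fin_cases i <;> fin_cases j <;> simp [upper]

/-- A matrix of determinant one with `(A - 1) ^ n = 0` is conjugate to an upper unitriangular
matrix. -/
theorem exists_conj_upper {A : SpecialLinearGroup (Fin 2) F} {n : ℕ}
    (h : ((A : Matrix (Fin 2) (Fin 2) F) - 1) ^ n = 0) :
    ∃ (g : SpecialLinearGroup (Fin 2) F) (b : F), A * g = g * upper b := by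
  have hdet : ((A : Matrix (Fin 2) (Fin 2) F) - 1).det = 0 := by
    have := congrArg det h
    rw [det_pow, det_zero] at this
    by_contra hne
    exact pow_ne_zero n hne this
  obtain ⟨v, hv, hNv⟩ := exists_mulVec_eq_zero_iff.2 hdet
  rw [sub_mulVec, one_mulVec, sub_eq_zero] at hNv
  have hco : IsCoprime (v 0) (v 1) := by
    by_cases h0 : v 0 = 0
    · have h1 : v 1 ≠ 0 := fun h1 => hv (by ext i; fin_cases i <;> simp [h0, h1])
      exact ⟨0, (v 1)⁻¹, by simp [h1]⟩
    · exact ⟨(v 0)⁻¹, 0, by simp [h0]⟩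
  -- The fixed vector v is completed to a matrix of determinant one with first column v.
  obtain ⟨g, hg0, hg1⟩ := hco.exists_SL2_col 0
  have hgv : ∀ i, g i 0 = v i := by
    intro i; fin_cases i
    · exact hg0
    · exact hg1
  have hcol : ∀ i, ((A : Matrix (Fin 2) (Fin 2) F) * g) i 0 = (g : Matrix (Fin 2) (Fin 2) F) i 0 := by
    intro i
    have := congrFun hNv i
    rw [mul_apply]
    simp only [hgv]
    exact this
  have hU : ∀ i, ((g⁻¹ * (A * g) : SpecialLinearGroup (Fin 2) F) : Matrix (Fin 2) (Fin 2) F) i 0 =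
      (1 : Matrix (Fin 2) (Fin 2) F) i 0 := by
    intro i
    rw [coe_mul, coe_mul, mul_apply]
    simp only [hcol]
    rw [← mul_apply, ← coe_mul, inv_mul_cancel, coe_one]
  refine ⟨g, (g⁻¹ * (A * g)) 0 1, ?_⟩
  rw [← inv_mul_eq_iff_eq_mul]
  set U := g⁻¹ * (A * g)
  have h0 := hU 0
  have h1 := hU 1
  have hd := U.det_coe
  rw [det_fin_two, h0, h1] at hd
  simp at h0 h1 hd
  ext i j
  fin_cases i <;> fin_cases j <;> simp [coe_upper, h0, h1, hd]

/-- Upper unitriangular matrices are conjugate only when their off-diagonal entries differ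
by a square factor. -/
theorem exists_of_upper_conj {b c : F} (hb : b ≠ 0) {g : SpecialLinearGroup (Fin 2) F}
    (h : g * upper b = upper c * g) : ∃ e : F, c = e * e * b := by
  have hdet := g.det_coe
  rw [det_fin_two] at hdet
  have h' := congrArg Subtype.val h
  rw [coe_mul, coe_mul, coe_upper, coe_upper] at h'
  have h2 := congrFun (congrFun h' 0) 1
  have h3 := congrFun (congrFun h' 1) 1
  simp [mul_apply, Fin.sum_univ_two, hb] at h2 h3
  -- The entries give g₁₀ = 0 and g₀₀ b = c g₁₁, while the determinant gives g₀₀ g₁₁ = 1.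
  refine ⟨g 0 0, ?_⟩
  linear_combination (-(g 0 0)) * h2 - c * hdet - c * g 0 1 * h3

end SpecialLinearGroup

/-! ### Triple classes of PSL(2, F) and their traces -/

namespace ProjectiveSpecialLinearGroup

open Matrix.SpecialLinearGroup GrothendieckTeichmuller

variable {F : Type*} [Field F]

/-- The automorphism of `PSL(2, F)` given by conjugation by the diagonal matrix `(ν, 1)`. -/
def diagAut (ν : Fˣ) : MulAut (ProjectiveSpecialLinearGroup (Fin 2) F) :=
  QuotientGroup.congr _ _ (diagConj ν)
    (Subgroup.characteristic_iff_map_eq.1 inferInstance (diagConj ν))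

theorem diagAut_proj (ν : Fˣ) (A : SpecialLinearGroup (Fin 2) F) :
    diagAut ν (proj A) = proj (diagConj ν A) := rfl

theorem diagAut_one : diagAut (1 : Fˣ) = 1 := by
  ext x
  obtain ⟨A, rfl⟩ := proj_surjective x
  rw [diagAut_proj, MulAut.one_apply]
  congr 1
  apply Subtype.ext
  rw [coe_diagConj]
  ext i j
  fin_cases i <;> fin_cases j <;> simp

theorem diagAut_diagAut (ν : Fˣ) (x : ProjectiveSpecialLinearGroup (Fin 2) F) :
    diagAut ν (diagAut ν x) = MulAut.conj (proj (torus ν)) x := by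
  obtain ⟨A, rfl⟩ := proj_surjective x
  simp [diagAut_proj, diagConj_diagConj]

theorem Triple.ext_of_xy {G : Type*} [Group G] {t t' : Triple G} (hx : t.x = t'.x)
    (hy : t.y = t'.y) : t = t' :=
  Triple.ext hx hy (by rw [t.z_eq, t'.z_eq, hx, hy])

/-- Dividing P by a square root of its determinant puts it in SL(2,F) without changing conjugation
by it. -/
theorem mk_eq_mk_of_intertwiner {t t' : Triple (ProjectiveSpecialLinearGroup (Fin 2) F)}
    {A B A' B' : SpecialLinearGroup (Fin 2) F} (hA : proj A = t.x) (hB : proj B = t.y)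
    (hA' : proj A' = t'.x) (hB' : proj B' = t'.y) {P : Matrix (Fin 2) (Fin 2) F}
    (hPA : P * A = A' * P) (hPB : P * B = B' * P) (hdet : P.det ≠ 0) (hsq : IsSquare P.det) :
    (⟦t⟧ : TripleClass _) = ⟦t'⟧ := by
  obtain ⟨c, hc⟩ := hsq
  have hc0 : c ≠ 0 := by rintro rfl; simp [hc] at hdet
  let S : SpecialLinearGroup (Fin 2) F := ⟨c⁻¹ • P, by
    rw [det_smul, Fintype.card_fin, hc]; field_simp⟩
  have conj : ∀ {X X' : SpecialLinearGroup (Fin 2) F}, P * X = X' * P →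
      MulAut.conj (proj S) (proj X) = proj X' := by
    intro X X' h
    have : S * X = X' * S := by
      apply Subtype.ext
      rw [coe_mul, coe_mul]
      change (c⁻¹ • P) * _ = _ * (c⁻¹ • P)
      rw [Matrix.smul_mul, h, Matrix.mul_smul]
    rw [MulAut.conj_apply, ← map_mul, ← map_inv, ← map_mul, this, mul_inv_cancel_right]
  refine Quotient.sound ⟨proj S, Triple.ext_of_xy ?_ ?_⟩
  · rw [smul_x, ← hA, ← hA', conj hPA]
  · rw [smul_y, ← hB, ← hB', conj hPB]

/-- Two cases according to the intertwiner's determinant modulo squares; if it is not a square, the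
factor diag(ν⁻¹, 1) makes it one at the cost of the diagonal automorphism. -/
theorem mk_eq_mk_or_of_trace {ν : Fˣ} (hν : ∀ a : F, IsSquare a ∨ IsSquare (a * (ν⁻¹ : Fˣ)))
    {t t' : Triple (ProjectiveSpecialLinearGroup (Fin 2) F)}
    {A B A' B' : SpecialLinearGroup (Fin 2) F} (hA : proj A = t.x) (hB : proj B = t.y)
    (hA' : proj A' = t'.x) (hB' : proj B' = t'.y)
    (tA : (A : Matrix (Fin 2) (Fin 2) F).trace = (A' : Matrix (Fin 2) (Fin 2) F).trace)
    (tB : (B : Matrix (Fin 2) (Fin 2) F).trace = (B' : Matrix (Fin 2) (Fin 2) F).trace)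
    (tAB : ((A * B : SpecialLinearGroup (Fin 2) F) : Matrix (Fin 2) (Fin 2) F).trace =
      ((A' * B' : SpecialLinearGroup (Fin 2) F) : Matrix (Fin 2) (Fin 2) F).trace) :
    (⟦t⟧ : TripleClass _) = ⟦t'⟧ ∨ autAction _ (diagAut ν) ⟦t⟧ = ⟦t'⟧ := by
  have hgen : Subgroup.closure {proj A, proj B} = ⊤ := by
    rw [eq_top_iff, ← t.closure_eq_top, Subgroup.closure_le, hA, hB]
    have hx : t.x ∈ Subgroup.closure {t.x, t.y} := Subgroup.subset_closure (by simp)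
    have hy : t.y ∈ Subgroup.closure {t.x, t.y} := Subgroup.subset_closure (by simp)
    rintro w (rfl | rfl | rfl)
    · exact hx
    · exact hy
    · rw [t.z_eq]; exact mul_mem (inv_mem hy) (inv_mem hx)
  obtain ⟨P, hdet, hPA, hPB⟩ := exists_intertwiner A.det_coe B.det_coe A'.det_coe B'.det_coe
    tA tB (by simpa using tAB) (adjoin_eq_top hgen)
  rcases hν P.det with hs | hs
  · exact Or.inl (mk_eq_mk_of_intertwiner hA hB hA' hB' hPA hPB hdet hs)
  · right
    rw [autAction_mk]
    have hdet' : (P * !![((ν⁻¹ : Fˣ) : F), 0; 0, 1]).det = P.det * (ν⁻¹ : Fˣ) := by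
      rw [det_mul, det_fin_two_of]; simp
    refine mk_eq_mk_of_intertwiner (A := diagConj ν A) (B := diagConj ν B)
      (P := P * !![((ν⁻¹ : Fˣ) : F), 0; 0, 1]) ?_ ?_ hA' hB' ?_ ?_ ?_ ?_
    · rw [smul_x, ← hA]; rfl
    · rw [smul_y, ← hB]; rfl
    · rw [mul_assoc, diagConj_mul_diag, ← mul_assoc, hPA, mul_assoc]
    · rw [mul_assoc, diagConj_mul_diag, ← mul_assoc, hPB, mul_assoc]
    · rw [hdet']; exact mul_ne_zero hdet (Units.ne_zero _)
    · rwa [hdet']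

theorem exists_lift_trace {x x' : ProjectiveSpecialLinearGroup (Fin 2) F} (h : IsConj x x')
    {A : SpecialLinearGroup (Fin 2) F} (hA : proj A = x) :
    ∃ A' : SpecialLinearGroup (Fin 2) F, proj A' = x' ∧
      (A : Matrix (Fin 2) (Fin 2) F).trace = (A' : Matrix (Fin 2) (Fin 2) F).trace := by
  obtain ⟨A', rfl⟩ := proj_surjective x'
  subst hA
  rcases trace_of_isConj h with h | h
  · exact ⟨A', rfl, h.symm⟩
  · exact ⟨-A', proj_neg A', by simp [h]⟩

theorem Triple.z_eq_proj {t : Triple (ProjectiveSpecialLinearGroup (Fin 2) F)}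
    {A B : SpecialLinearGroup (Fin 2) F} (hA : proj A = t.x) (hB : proj B = t.y) :
    t.z = proj (A * B)⁻¹ := by
  rw [map_inv, map_mul, hA, hB]
  exact eq_inv_of_mul_eq_one_right t.mul_eq_one

/-- The signs of the lifts A' and B' are chosen to match the traces of A and B. The sign of tr A'B'
is then no longer free. -/
theorem exists_lifts {t t' : Triple (ProjectiveSpecialLinearGroup (Fin 2) F)}
    (h : CoordConj ⟦t⟧ ⟦t'⟧) {A B : SpecialLinearGroup (Fin 2) F}
    (hA : proj A = t.x) (hB : proj B = t.y) :
    ∃ A' B' : SpecialLinearGroup (Fin 2) F, proj A' = t'.x ∧ proj B' = t'.y ∧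
      (A : Matrix (Fin 2) (Fin 2) F).trace = (A' : Matrix (Fin 2) (Fin 2) F).trace ∧
      (B : Matrix (Fin 2) (Fin 2) F).trace = (B' : Matrix (Fin 2) (Fin 2) F).trace ∧
      (((A' * B' : SpecialLinearGroup (Fin 2) F) : Matrix (Fin 2) (Fin 2) F).trace =
        ((A * B : SpecialLinearGroup (Fin 2) F) : Matrix (Fin 2) (Fin 2) F).trace ∨
      ((A' * B' : SpecialLinearGroup (Fin 2) F) : Matrix (Fin 2) (Fin 2) F).trace =
        -((A * B : SpecialLinearGroup (Fin 2) F) : Matrix (Fin 2) (Fin 2) F).trace) := by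
  obtain ⟨h1, h2, h3⟩ := h
  obtain ⟨A', hA', tA⟩ := exists_lift_trace h1 hA
  obtain ⟨B', hB', tB⟩ := exists_lift_trace h2 hB
  refine ⟨A', B', hA', hB', tA, tB, ?_⟩
  change IsConj t.z t'.z at h3
  rw [Triple.z_eq_proj hA hB, Triple.z_eq_proj hA' hB'] at h3
  simpa only [trace_coe_inv] using trace_of_isConj h3

theorem eq_of_coordConj (h2 : (2 : F) = 0) (hsq : ∀ a : F, IsSquare a)
    {c c' : TripleClass (ProjectiveSpecialLinearGroup (Fin 2) F)} (h : CoordConj c c') :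
    c = c' := by
  induction c using Quotient.inductionOn with
  | h t =>
  induction c' using Quotient.inductionOn with
  | h t' =>
  obtain ⟨A, hA⟩ := proj_surjective t.x
  obtain ⟨B, hB⟩ := proj_surjective t.y
  obtain ⟨A', B', hA', hB', tA, tB, tAB⟩ := exists_lifts h hA hB
  have hneg : ∀ a : F, -a = a := fun a => by linear_combination (-a) * h2
  rw [hneg, or_self] at tAB
  rcases mk_eq_mk_or_of_trace (ν := 1) (fun a => Or.inl (hsq a)) hA hB hA' hB' tA tB tAB.symm
    with h | h
  · exact h
  · rw [← h, diagAut_one, map_one, Equiv.Perm.one_apply]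

/-- Among three coordinatewise conjugate classes, two agree up to the diagonal automorphism. -/
theorem eq_or_of_coordConj {ν : Fˣ} (hν : ∀ a : F, IsSquare a ∨ IsSquare (a * (ν⁻¹ : Fˣ)))
    {c₁ c₂ c₃ : TripleClass (ProjectiveSpecialLinearGroup (Fin 2) F)}
    (h₂ : CoordConj c₁ c₂) (h₃ : CoordConj c₁ c₃) :
    (c₁ = c₂ ∨ autAction _ (diagAut ν) c₁ = c₂) ∨ (c₁ = c₃ ∨ autAction _ (diagAut ν) c₁ = c₃) ∨
      (c₂ = c₃ ∨ autAction _ (diagAut ν) c₂ = c₃) := by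
  induction c₁ using Quotient.inductionOn with
  | h t₁ =>
  induction c₂ using Quotient.inductionOn with
  | h t₂ =>
  induction c₃ using Quotient.inductionOn with
  | h t₃ =>
  obtain ⟨A, hA⟩ := proj_surjective t₁.x
  obtain ⟨B, hB⟩ := proj_surjective t₁.y
  obtain ⟨A₂, B₂, hA₂, hB₂, tA₂, tB₂, tAB₂⟩ := exists_lifts h₂ hA hB
  obtain ⟨A₃, B₃, hA₃, hB₃, tA₃, tB₃, tAB₃⟩ := exists_lifts h₃ hA hB
  rcases tAB₂ with h | h
  -- Pigeonhole on the sign of the third trace: when both other signs are opposite to the first,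
  -- they agree with each other.
  · exact Or.inl (mk_eq_mk_or_of_trace hν hA hB hA₂ hB₂ tA₂ tB₂ h.symm)
  rcases tAB₃ with h' | h'
  · exact Or.inr (Or.inl (mk_eq_mk_or_of_trace hν hA hB hA₃ hB₃ tA₃ tB₃ h'.symm))
  · exact Or.inr (Or.inr (mk_eq_mk_or_of_trace hν hA₂ hB₂ hA₃ hB₃ (tA₂.symm.trans tA₃)
      (tB₂.symm.trans tB₃) (h.trans h'.symm)))

/-- Elements of order dividing `p` are unipotent up to sign. -/
theorem exists_isConj_upper {p : ℕ} [Fact p.Prime] [CharP F p] (hp : Odd p)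
    {x : ProjectiveSpecialLinearGroup (Fin 2) F} (hx : x ^ p = 1) :
    ∃ b : F, IsConj (proj (upper b)) x := by
  have main : ∀ A : SpecialLinearGroup (Fin 2) F, A ^ p = 1 →
      ∃ b : F, IsConj (proj (upper b)) (proj A) := by
    intro A hA
    have hN : ((A : Matrix (Fin 2) (Fin 2) F) - 1) ^ p = 0 := by
      have hc : Commute (A : Matrix (Fin 2) (Fin 2) F) 1 := Commute.one_right _
      rw [sub_pow_char_of_commute p hc, ← coe_pow, hA]
      simp
    obtain ⟨g, b, hg⟩ := exists_conj_upper hN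
    refine ⟨b, isConj_iff.2 ⟨proj g, ?_⟩⟩
    rw [← map_mul, ← hg, map_mul, mul_inv_cancel_right]
  obtain ⟨A, rfl⟩ := proj_surjective x
  rw [← map_pow, ← map_one proj, proj_eq_proj_iff] at hx
  rcases hx with h | h
  · exact main A h
  · rw [← proj_neg]
    exact main (-A) (by rw [hp.neg_pow, h, neg_neg])

theorem not_isConj_diagAut {ν : Fˣ} (hν : ¬ IsSquare (ν : F)) (h2 : (2 : F) ≠ 0) :
    ¬ IsConj (proj (upper (1 : F))) (diagAut ν (proj (upper 1))) := by
  rw [diagAut_proj, diagConj_upper, isConj_iff]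
  rintro ⟨c, hc⟩
  obtain ⟨g, rfl⟩ := proj_surjective c
  rw [← map_mul, ← map_inv, ← map_mul, proj_eq_proj_iff] at hc
  rcases hc with hc | hc
  · rw [mul_inv_eq_iff_eq_mul] at hc
    obtain ⟨e, he⟩ := exists_of_upper_conj one_ne_zero hc
    exact hν ⟨e, by simpa using he⟩
  -- The sign −1 is excluded by traces: it would give 2 = −2.
  · have h3 := congrArg (fun X : SpecialLinearGroup (Fin 2) F =>
      (X : Matrix (Fin 2) (Fin 2) F).trace) hc
    simp only [coe_mul, coe_neg, trace_neg] at h3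
    rw [trace_mul_comm, ← mul_assoc, ← coe_mul, inv_mul_cancel] at h3
    simp [coe_upper, trace_fin_two] at h3
    have : (2 : F) * 2 = 0 := by linear_combination h3
    simp [h2] at this

theorem isConj_upper_or {ν : Fˣ} (hν : ∀ a : F, IsSquare a ∨ IsSquare (a * (ν⁻¹ : Fˣ))) {b : F}
    (hb : b ≠ 0) : IsConj (proj (upper 1)) (proj (upper b)) ∨
      IsConj (diagAut ν (proj (upper 1))) (proj (upper b)) := by
  have key : ∀ {c e : F}, b = e * e * c → IsConj (proj (upper c)) (proj (upper b)) := by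
    intro c e h
    have he : e ≠ 0 := by rintro rfl; simp [h] at hb
    have := torus_mul_upper (Units.mk0 e he) c
    rw [Units.val_mk0, ← h] at this
    refine isConj_iff.2 ⟨proj (torus (Units.mk0 e he)), ?_⟩
    rw [← map_mul, this, map_mul, mul_inv_cancel_right]
  rcases hν b with ⟨e, he⟩ | ⟨e, he⟩
  · exact Or.inl (key (by rw [mul_one, he]))
  · right
    rw [diagAut_proj, diagConj_upper]
    refine key (e := e) ?_
    rw [← he, mul_one]; simp

/-- The diagonal automorphism is not, modulo inner automorphisms, a square: it exchanges
the two classes of elements of order `p`. -/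
theorem not_square_diagAut {p : ℕ} [Fact p.Prime] [CharP F p] (hp : Odd p) {ν : Fˣ}
    (hν : ∀ a : F, IsSquare a ∨ IsSquare (a * (ν⁻¹ : Fˣ))) (hν' : ¬ IsSquare (ν : F))
    (a : MulAut (ProjectiveSpecialLinearGroup (Fin 2) F))
    (g : ProjectiveSpecialLinearGroup (Fin 2) F)
    (h : ∀ x, MulAut.conj g (a (a x)) = diagAut ν x) : False := by
  have h2 : (2 : F) ≠ 0 := by
    apply Ring.two_ne_zero
    rw [ringChar.eq F p]
    rintro rfl
    exact absurd hp (by decide)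
  set u := proj (upper (1 : F)) with hu
  have hn := not_isConj_diagAut hν' h2
  have map : ∀ (b : MulAut (ProjectiveSpecialLinearGroup (Fin 2) F))
      {x y : ProjectiveSpecialLinearGroup (Fin 2) F}, IsConj x y → IsConj (b x) (b y) :=
    fun b x y hxy => b.toMonoidHom.map_isConj hxy
  have haa : ∀ x, IsConj (a (a x)) (diagAut ν x) := fun x => h x ▸ isConj_smul _ _
  have hup : u ^ p = 1 := by
    have : ((upper (1 : F) : Matrix (Fin 2) (Fin 2) F) - 1) ^ 2 = 0 := by
      rw [coe_upper, sq]
      ext i j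
      fin_cases i <;> fin_cases j <;> simp [mul_apply, Fin.sum_univ_two]
    have hpp : ((upper (1 : F) : Matrix (Fin 2) (Fin 2) F) - 1) ^ p = 0 :=
      pow_eq_zero_of_le (Fact.out : p.Prime).two_le this
    rw [sub_pow_char_of_commute p (Commute.one_right _), one_pow, sub_eq_zero, ← coe_pow] at hpp
    have hpp' : upper (1 : F) ^ p = 1 := Subtype.ext hpp
    rw [hu, ← map_pow, hpp', map_one]
  obtain ⟨b, hb⟩ := exists_isConj_upper (F := F) hp (x := a u) (by rw [← map_pow, hup, map_one])
  have hb0 : b ≠ 0 := by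
    rintro rfl
    rw [upper_zero, map_one, isConj_one_right] at hb
    have : u = 1 := a.injective (hb.trans (map_one a).symm)
    rw [← hu, this, map_one] at hn
    exact hn (IsConj.refl 1)
  -- With only two classes available, a either fixes or exchanges those of u and d(u); in both cases
  -- a² fixes them, whereas d does not.
  rcases isConj_upper_or hν hb0 with h1 | h1
  · have h3 : IsConj u (a u) := h1.trans hb
    exact hn (h3.trans ((map a h3).trans (haa u)))
  · have h3 : IsConj (diagAut ν u) (a u) := h1.trans hb
    have h4 : IsConj (a (diagAut ν u)) (diagAut ν u) := (map a h3).trans (haa u)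
    have h5 : IsConj (a u) (a (diagAut ν u)) := (h4.trans h3).symm
    have h6 := map a⁻¹ h5
    rw [MulAut.inv_apply_self, MulAut.inv_apply_self] at h6
    exact hn h6

end ProjectiveSpecialLinearGroup
end Matrix

/-! ### Elementary abelian 2-groups and the dihedral group of order 8 -/

theorem exists_mulEquiv_pi_zmod_two {E : Type*} [Group E] [Finite E] (h : ∀ x : E, x * x = 1) :
    ∃ n : ℕ, Nonempty (E ≃* (Fin n → Multiplicative (ZMod 2))) := by
  let _ : CommGroup E :=
    { (inferInstance : Group E) with
      mul_comm := fun a b => by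
        have ha := eq_inv_of_mul_eq_one_left (h a)
        have hb := eq_inv_of_mul_eq_one_left (h b)
        have hab := eq_inv_of_mul_eq_one_left (h (a * b))
        rw [hab, mul_inv_rev, ← ha, ← hb] }
  let _ : Module (ZMod 2) (Additive E) :=
    AddCommGroup.zmodModule (n := 2) (fun x => by rw [two_nsmul]; exact h x.toMul)
  let b := Module.finBasis (ZMod 2) (Additive E)
  exact ⟨Module.finrank (ZMod 2) (Additive E), ⟨
    { toFun := fun e i => Multiplicative.ofAdd (b.equivFun (Additive.ofMul e) i)
      invFun := fun f => (b.equivFun.symm fun i => (f i).toAdd).toMul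
      left_inv := fun e => by simp
      right_inv := fun f => by
        funext i
        simp only [ofMul_toMul, LinearEquiv.apply_symm_apply, ofAdd_toAdd]
      map_mul' := fun e e' => by
        funext i
        simp only [ofMul_mul, map_add, Pi.add_apply, ofAdd_add, Pi.mul_apply] }⟩⟩

namespace DihedralGroup

/-- The action of the dihedral group of order `8` on `ℤ/4`. -/
def permZMod : DihedralGroup 4 →* Equiv.Perm (ZMod 4) where
  toFun
    | r i => Equiv.subRight i
    | sr i => Equiv.subLeft i
  map_one' := by
    rw [one_def]
    ext k
    simp
  map_mul' := by
    rintro (i | i) (j | j) <;> ext k <;> simp <;> ring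

theorem permZMod_r (i k : ZMod 4) : permZMod (r i) k = k - i := rfl

theorem permZMod_sr (i k : ZMod 4) : permZMod (sr i) k = i - k := rfl

theorem permZMod_injective : Function.Injective permZMod := by
  rintro (i | i) (j | j) h
  · have := congrArg (· 0) h
    simp only [permZMod_r, zero_sub, neg_inj] at this
    rw [this]
  · have h0 := congrArg (· 0) h
    have h1 := congrArg (· 1) h
    simp only [permZMod_r, permZMod_sr] at h0 h1
    revert i j
    decide
  · have h0 := congrArg (· 0) h
    have h1 := congrArg (· 1) h
    simp only [permZMod_r, permZMod_sr] at h0 h1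
    revert i j
    decide
  · have := congrArg (· 0) h
    simp only [permZMod_sr, sub_zero] at this
    rw [this]

theorem permZMod_add_two (g : DihedralGroup 4) (k : ZMod 4) :
    permZMod g (k + 2) = permZMod g k + 2 := by
  rcases g with i | i
  · rw [permZMod_r, permZMod_r]; ring
  · rw [permZMod_sr, permZMod_sr]
    revert i k
    decide

/-- Such τ is determined by τ 0 and τ 1, and τ 1 = τ 0 ± 1: the plus sign gives a rotation, the
minus sign a reflection. -/
theorem exists_permZMod_eq {τ : Equiv.Perm (ZMod 4)} (h : ∀ k, τ (k + 2) = τ k + 2) :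
    ∃ g, permZMod g = τ := by
  have h2 : τ 2 = τ 0 + 2 := by simpa using h 0
  have h3 : τ 3 = τ 1 + 2 := h 1
  have n1 : τ 1 ≠ τ 0 := τ.injective.ne (by decide)
  have n2 : τ 1 ≠ τ 0 + 2 := h2 ▸ τ.injective.ne (by decide)
  have key : ∀ a b : ZMod 4, b ≠ a → b ≠ a + 2 → b = a + 1 ∨ b = a - 1 := by decide
  have cases4 : ∀ k : ZMod 4, k = 0 ∨ k = 1 ∨ k = 2 ∨ k = 3 := by decide
  rcases key _ _ n1 n2 with h1 | h1
  · refine ⟨r (-τ 0), Equiv.ext fun k => ?_⟩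
    rw [permZMod_r]
    rcases cases4 k with rfl | rfl | rfl | rfl
    · ring
    · rw [h1]; ring
    · rw [h2]; ring
    · rw [h3, h1]; ring
  · refine ⟨sr (τ 0), Equiv.ext fun k => ?_⟩
    rw [permZMod_sr]
    rcases cases4 k with rfl | rfl | rfl | rfl
    · ring
    · rw [h1]
    · rw [h2]; generalize τ 0 = a; revert a; decide
    · rw [h3, h1]; generalize τ 0 = a; revert a; decide

/-- The permutations of a four-element set commuting with a fixed-point-free involution form a
dihedral group of order `8`. -/
theorem nonempty_mulEquiv_of_commute {C : Type*} (K : Subgroup (Equiv.Perm C)) (D : C → C)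
    (e : ZMod 4 ≃ C) (he : ∀ i, e (i + 2) = D (e i))
    (hK : ∀ χ, χ ∈ K ↔ ∀ c, χ (D c) = D (χ c)) : Nonempty (K ≃* DihedralGroup 4) := by
  let f : DihedralGroup 4 →* Equiv.Perm C := e.permCongrHom.toMonoidHom.comp permZMod
  have hf : ∀ g i, f g (e i) = e (permZMod g i) := fun g i => by
    change e (permZMod g (e.symm (e i))) = _
    rw [e.symm_apply_apply]
  have hfK : ∀ g, f g ∈ K := fun g => by
    rw [hK]
    intro c
    obtain ⟨i, rfl⟩ := e.surjective c
    rw [← he, hf, hf, permZMod_add_two, he]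
  refine ⟨(MulEquiv.ofBijective (f.codRestrict K hfK) ⟨?_, ?_⟩).symm⟩
  · intro g g' h
    apply permZMod_injective
    apply e.permCongrHom.injective
    exact congrArg Subtype.val h
  · rintro ⟨χ, hχ⟩
    obtain ⟨g, hg⟩ := exists_permZMod_eq (τ := e.permCongrHom.symm χ) (fun k => by
      change e.symm (χ (e (k + 2))) = e.symm (χ (e k)) + 2
      rw [he, (hK χ).1 hχ, Equiv.symm_apply_eq, he, e.apply_symm_apply])
    refine ⟨g, Subtype.ext ?_⟩
    change e.permCongrHom (permZMod g) = χ
    rw [hg, MulEquiv.apply_symm_apply]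

end DihedralGroup

/-! ### Equivariant permutations preserving the classes of a relation -/

namespace Equiv.Perm

variable {H X : Type*} [Group H] (ρ : H →* Equiv.Perm X) (r : Setoid X)

/-- The permutations that commute with an action and preserve every class of a relation. -/
def equivariant : Subgroup (Equiv.Perm X) where
  carrier := {φ | (∀ h x, φ (ρ h x) = ρ h (φ x)) ∧ ∀ x, r x (φ x)}
  one_mem' := ⟨fun _ _ => rfl, fun x => r.refl x⟩
  mul_mem' := by
    rintro φ ψ ⟨h1, h2⟩ ⟨k1, k2⟩
    exact ⟨fun h x => by rw [mul_apply, mul_apply, k1, h1], fun x => r.trans (k2 x) (h2 _)⟩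
  inv_mem' := by
    rintro φ ⟨h1, h2⟩
    have hφ : ∀ x, φ (φ⁻¹ x) = x := φ.apply_symm_apply
    refine ⟨fun h x => by rw [inv_eq_iff_eq, h1, hφ], fun x => ?_⟩
    have := h2 (φ⁻¹ x)
    rw [hφ] at this
    exact r.symm this

/-- The permutations of the class of `x` that commute with the partial action on this class. -/
def equivariantOn (x : X) : Subgroup (Equiv.Perm {y // r x y}) where
  carrier := {ψ | ∀ (h : H) (y z : {y // r x y}), ρ h y = z ↔ ρ h (ψ y) = ψ z}
  one_mem' := fun _ _ _ => Iff.rfl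
  mul_mem' := fun {φ ψ} hφ hψ h y z => (hψ h y z).trans (hφ h _ _)
  inv_mem' := fun {φ} hφ h y z => by
    have h1 : ∀ x, φ (φ⁻¹ x) = x := φ.apply_symm_apply
    rw [hφ h (φ⁻¹ y), h1, h1]

/-- If h carries one point of the class into the class, it carries every point into it, so the
forward implication applies to ρ h y and injectivity of ψ gives the converse. -/
theorem mem_equivariantOn_iff {ρ : H →* Equiv.Perm X} {r : Setoid X}
    (hr : ∀ h x y, r x y → r (ρ h x) (ρ h y)) {x : X} {ψ : Equiv.Perm {y // r x y}} :
    ψ ∈ equivariantOn ρ r x ↔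
      ∀ (h : H) (y z : {y // r x y}), ρ h y = z → ρ h (ψ y) = ψ z := by
  refine ⟨fun hψ h y z => (hψ h y z).1, fun hψ h y z => ⟨hψ h y z, fun e => ?_⟩⟩
  have h1 : r (ρ h (ψ y)) (ρ h y) := hr h _ _ (r.trans (r.symm (ψ y).2) y.2)
  have h2 : r x (ρ h y) := r.trans (e ▸ (ψ z).2 : r x (ρ h (ψ y))) h1
  have h3 := hψ h y ⟨ρ h y, h2⟩ rfl
  rw [e] at h3
  exact congrArg Subtype.val (ψ.injective (Subtype.ext h3)).symm

/-- The relation generated by an invariant equivalence relation and the orbits of an action. -/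
def orbitSetoid (hr : ∀ h x y, r x y → r (ρ h x) (ρ h y)) : Setoid X where
  r x y := ∃ h, r (ρ h x) y
  iseqv :=
    { refl := fun x => ⟨1, by rw [map_one]; exact r.refl x⟩
      symm := by
        rintro x y ⟨h, hxy⟩
        refine ⟨h⁻¹, r.symm ?_⟩
        simpa using hr h⁻¹ _ _ hxy
      trans := by
        rintro x y z ⟨h, hxy⟩ ⟨k, hyz⟩
        refine ⟨k * h, r.trans ?_ hyz⟩
        rw [map_mul, mul_apply]
        exact hr k _ _ hxy }

variable {ρ r}

/-- Restriction of an equivariant permutation to a class. -/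
def equivariantRestrict (x : X) : equivariant ρ r →* equivariantOn ρ r x where
  toFun φ := ⟨(φ : Equiv.Perm X).subtypePerm (fun y =>
      ⟨fun h => r.trans h (r.symm (φ.2.2 y)), fun h => r.trans h (φ.2.2 y)⟩), fun h y z => by
    change _ ↔ ρ h ((φ : Equiv.Perm X) y) = (φ : Equiv.Perm X) z
    rw [← φ.2.1, (φ : Equiv.Perm X).injective.eq_iff]⟩
  map_one' := rfl
  map_mul' _ _ := rfl

/-- An equivariant permutation amounts to a permutation of one class in each orbit of classes,
commuting with the stabilizer of the class. -/
theorem nonempty_equivariant_mulEquiv_pi (hr : ∀ h x y, r x y → r (ρ h x) (ρ h y)) :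
    Nonempty (equivariant ρ r ≃* ∀ ω : Quotient (orbitSetoid ρ r hr),
      equivariantOn ρ r ω.out) := by
  classical
  let Ω := Quotient (orbitSetoid ρ r hr)
  have hrep : ∀ x : X, ∃ h : H, r (Quotient.out (⟦x⟧ : Ω)) (ρ h x) := fun x => by
    obtain ⟨h, hh⟩ : ∃ h, r (ρ h x) (Quotient.out (⟦x⟧ : Ω)) :=
      (orbitSetoid ρ r hr).symm (Quotient.mk_out (s := orbitSetoid ρ r hr) x)
    exact ⟨h, r.symm hh⟩
  have hinv : ∀ (h : H) (x : X), ρ h⁻¹ (ρ h x) = x := fun h x => by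
    rw [← mul_apply, ← map_mul, inv_mul_cancel, map_one, one_apply]
  refine ⟨MulEquiv.ofBijective (MonoidHom.pi fun ω => equivariantRestrict ω.out) ⟨?_, ?_⟩⟩
  · intro φ φ' h
    ext x
    obtain ⟨k, hk⟩ := hrep x
    have h1 := congrArg (fun ψ => (ψ.1 ⟨ρ k x, hk⟩ : X))
      (congrFun h (⟦x⟧ : Ω))
    change (φ : Equiv.Perm X) (ρ k x) = (φ' : Equiv.Perm X) (ρ k x) at h1
    rw [φ.2.1, φ'.2.1] at h1
    exact (ρ k).injective h1
  · intro ψ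
    choose k hk using hrep
    -- the extension of a family of permutations of representative classes
    let E : (∀ ω : Ω, equivariantOn ρ r ω.out) → X → X := fun ψ x =>
      ρ (k x)⁻¹ ((ψ ⟦x⟧).1 ⟨ρ (k x) x, hk x⟩ : X)
    have hE' : ∀ ψ (h : H) (x : X) (ω : Ω) (y : {y // r ω.out y}), ω = ⟦x⟧ → x = ρ h y →
        E ψ x = ρ h ((ψ ω).1 y : X) := by
      intro ψ h x ω y hω hx
      subst hω
      have := (ψ ⟦x⟧).2 (k x * h) y ⟨ρ (k x) x, hk x⟩ |>.1 (by rw [map_mul, mul_apply, ← hx])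
      change ρ _ _ = ρ _ _
      rw [← this, map_mul, mul_apply, hinv]
    have hE : ∀ ψ (h : H) (ω : Ω) (y : {y // r ω.out y}), E ψ (ρ h y) =
        ρ h ((ψ ω).1 y : X) := by
      intro ψ h ω y
      refine hE' ψ h _ ω y ?_ rfl
      have : (⟦ω.out⟧ : Ω) = ⟦ρ h y⟧ :=
        Quotient.sound (s := orbitSetoid ρ r hr) ⟨h, hr h _ _ y.2⟩
      rw [← this, Quotient.out_eq]
    have hforall : ∀ x : X, ∃ (h : H) (ω : Ω) (y : {y // r ω.out y}), x = ρ h y := fun x =>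
      ⟨(k x)⁻¹, ⟦x⟧, ⟨ρ (k x) x, hk x⟩, (hinv _ _).symm⟩
    have hmul : ∀ ψ ψ' x, E ψ (E ψ' x) = E (ψ * ψ') x := by
      intro ψ ψ' x
      obtain ⟨h, ω, y, rfl⟩ := hforall x
      rw [hE ψ' h ω y, hE ψ h ω ((ψ' ω).1 y), hE (ψ * ψ') h ω y]
      rfl
    have hone : ∀ x, E 1 x = x := by
      intro x
      obtain ⟨h, ω, y, rfl⟩ := hforall x
      rw [hE]
      rfl
    let φ : Equiv.Perm X :=
      { toFun := E ψ
        invFun := E ψ⁻¹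
        left_inv := fun x => by rw [hmul, inv_mul_cancel, hone]
        right_inv := fun x => by rw [hmul, mul_inv_cancel, hone] }
    have hφ : φ ∈ equivariant ρ r := by
      refine ⟨fun h x => ?_, fun x => ?_⟩
      · obtain ⟨h', ω, y, rfl⟩ := hforall x
        change E ψ _ = ρ h (E ψ _)
        rw [hE, ← mul_apply, ← mul_apply, ← map_mul, hE]
      · obtain ⟨h, ω, y, rfl⟩ := hforall x
        change r _ (E ψ _)
        rw [hE]
        exact hr h _ _ (r.trans (r.symm y.2) ((ψ ω).1 y).2)
    refine ⟨⟨φ, hφ⟩, ?_⟩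
    funext ω
    apply Subtype.ext
    ext y
    change E ψ y = _
    simpa using hE ψ 1 ω y

/-- The local factors of exponent dividing 2 are collected into a single elementary abelian group,
whose rank is n₁; n₂ counts the remaining factors. -/
theorem exists_equivariant_mulEquiv [Finite X] (hr : ∀ h x y, r x y → r (ρ h x) (ρ h y))
    (hloc : ∀ x, (∀ ψ ∈ equivariantOn ρ r x, ψ * ψ = 1) ∨
      Nonempty (equivariantOn ρ r x ≃* DihedralGroup 4)) :
    ∃ n₁ n₂ : ℕ, Nonempty (equivariant ρ r ≃*
      (Fin n₁ → Multiplicative (ZMod 2)) × (Fin n₂ → DihedralGroup 4)) := by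
  classical
  obtain ⟨e⟩ := nonempty_equivariant_mulEquiv_pi hr
  let Ω := Quotient (orbitSetoid ρ r hr)
  let K : Ω → Type _ := fun ω => equivariantOn ρ r ω.out
  let p : Ω → Prop := fun ω => ∀ ψ ∈ equivariantOn ρ r ω.out, ψ * ψ = 1
  let split : (∀ ω, K ω) ≃* (∀ ω : {ω // p ω}, K ω) × (∀ ω : {ω // ¬ p ω}, K ω) :=
    { Equiv.piEquivPiSubtypeProd p K with
      map_mul' := fun _ _ => rfl }
  obtain ⟨n₁, ⟨e₁⟩⟩ := exists_mulEquiv_pi_zmod_two (E := ∀ ω : {ω // p ω}, K ω) (fun ψ => by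
    funext ω
    exact Subtype.ext (ω.2 _ (ψ ω).2))
  have hd : ∀ ω : {ω // ¬ p ω}, Nonempty (K ω ≃* DihedralGroup 4) := fun ω =>
    (hloc _).resolve_left ω.2
  obtain ⟨n₂, ⟨e₂⟩⟩ := Finite.exists_equiv_fin {ω // ¬ p ω}
  refine ⟨n₁, n₂, ⟨e.trans (split.trans (MulEquiv.prodCongr e₁ ?_))⟩⟩
  exact (MulEquiv.piCongrRight fun ω => (hd ω).some).trans
    (MulEquiv.arrowCongr e₂ (MulEquiv.refl _))

/-- A class meets at most two d-orbits. If d moves it to another class, it has at most two points.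
Otherwise a non-involution ψ must be a 4-cycle with square d, and `hsq` keeps the stabilizer from
acting by ψ or ψ⁻¹. -/
theorem equivariantOn_dichotomy (hr : ∀ h x y, r x y → r (ρ h x) (ρ h y)) (d : H)
    (hfree : ∀ x, ρ d x ≠ x) (hdd : ∀ x, ρ d (ρ d x) = x)
    (hthree : ∀ x y z, r x y → r x z →
      (x = y ∨ ρ d x = y) ∨ (x = z ∨ ρ d x = z) ∨ (y = z ∨ ρ d y = z))
    (hsq : ∀ h x, ρ h (ρ h x) = ρ d x → ρ h (ρ h (ρ d x)) = x → False) (x : X) :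
    (∀ ψ ∈ equivariantOn ρ r x, ψ * ψ = 1) ∨
      Nonempty (equivariantOn ρ r x ≃* DihedralGroup 4) := by
  have three : ∀ a b c : {y // r x y},
      ((a : X) = b ∨ ρ d a = b) ∨ ((a : X) = c ∨ ρ d a = c) ∨ ((b : X) = c ∨ ρ d b = c) :=
    fun a b c => hthree _ _ _ (r.trans (r.symm a.2) b.2) (r.trans (r.symm a.2) c.2)
  by_cases hx : r x (ρ d x)
  swap
  · left
    intro ψ _
    have hne : ∀ a b : {y // r x y}, ρ d a ≠ b := fun a b h => hx <| by
      have h1 : r (ρ d x) b := h ▸ hr d _ _ a.2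
      exact r.trans b.2 (r.symm h1)
    ext a
    congr 1
    rw [mul_apply, one_apply]
    have := three a (ψ a) (ψ (ψ a))
    simp only [hne, or_false] at this
    rcases this with h | h | h
    · rw [← Subtype.ext h, ← Subtype.ext h]
    · exact (Subtype.ext h).symm
    · rw [← Subtype.ext h, ← ψ.injective (Subtype.ext h)]
  · by_cases hall : ∀ ψ ∈ equivariantOn ρ r x, ψ * ψ = 1
    · exact Or.inl hall
    right
    push Not at hall
    obtain ⟨ψ, hψ, hψ2⟩ := hall
    let D : {y // r x y} → {y // r x y} := fun a => ⟨ρ d a, r.trans hx (hr d _ _ a.2)⟩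
    have hDD : ∀ a, D (D a) = a := fun a => Subtype.ext (hdd a)
    have hDne : ∀ a, D a ≠ a := fun a h => hfree a (congrArg Subtype.val h)
    have three' : ∀ a b c : {y // r x y}, (a = b ∨ D a = b) ∨ (a = c ∨ D a = c) ∨ (b = c ∨ D b = c) :=
      fun a b c => by simpa only [D, Subtype.ext_iff] using three a b c
    have hcomm : ∀ χ ∈ equivariantOn ρ r x, ∀ a, χ (D a) = D (χ a) := fun χ hχ a =>
      Subtype.ext ((hχ d a (D a)).1 rfl).symm
    obtain ⟨y, hy⟩ : ∃ y, ψ (ψ y) ≠ y := by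
      by_contra! h
      exact hψ2 (Equiv.ext h)
    have hψD := hcomm ψ hψ
    have n1 : ψ y ≠ y := fun h => hy (by rw [h, h])
    have n2 : ψ y ≠ D y := fun h => hy (by rw [h, hψD, h, hDD])
    -- Neither ψ y nor ψ² y equals y, and ψ y lies outside the d-orbit of y. By pigeonhole ψ² y
    -- returns to that orbit.
    have hψψ : ψ (ψ y) = D y := by
      rcases three' y (ψ y) (ψ (ψ y)) with (h | h) | (h | h) | (h | h)
      · exact absurd h.symm n1
      · exact absurd h.symm n2
      · exact absurd h.symm hy
      · exact h.symm
      · exact absurd (ψ.injective h).symm n1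
      · rw [← hψD] at h
        exact absurd (ψ.injective h).symm n2
    have hcover : ∀ z, z = y ∨ z = ψ y ∨ z = D y ∨ z = D (ψ y) := by
      intro z
      rcases three' y (ψ y) z with (h | h) | (h | h) | (h | h)
      · exact absurd h.symm n1
      · exact absurd h.symm n2
      all_goals simp [← h]
    -- The points are listed in the cyclic order of ψ, so that adding 2 to the index is D.
    let f : Fin 4 → {y // r x y} := ![y, ψ y, D y, D (ψ y)]
    have n3 : D (ψ y) ≠ y := fun h => n2 (by conv_rhs => rw [← h, hDD])
    have n4 : D (ψ y) ≠ D y := fun h => n1 (by rw [← hDD (ψ y), h, hDD])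
    have hf : Function.Bijective f := by
      constructor
      · intro i j hij
        fin_cases i <;> fin_cases j <;>
          simp [f, hDne, n1, n2, n3, n4, n1.symm, n2.symm, n3.symm, n4.symm, (hDne _).symm] at hij ⊢
      · intro z
        rcases hcover z with rfl | rfl | rfl | rfl
        exacts [⟨0, rfl⟩, ⟨1, rfl⟩, ⟨2, rfl⟩, ⟨3, rfl⟩]
    let e : ZMod 4 ≃ {y // r x y} := Equiv.ofBijective f hf
    refine DihedralGroup.nonempty_mulEquiv_of_commute _ D e ?_
      fun χ => ⟨hcomm χ, fun hχ => (mem_equivariantOn_iff hr).2 ?_⟩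
    · intro i
      change f ((i + 2 : ZMod 4) : Fin 4) = D (f (i : Fin 4))
      fin_cases i
      · rfl
      · rfl
      · exact (hDD _).symm
      · exact (hDD _).symm
    · intro h a b hab
      have hst : ∀ c : {y // r x y}, r x (ρ h c) := fun c =>
        r.trans (r.trans b.2 (hab ▸ r.refl _)) (hr h _ _ (r.trans (r.symm a.2) c.2))
      let η : {y // r x y} → {y // r x y} := fun c => ⟨ρ h c, hst c⟩
      have hη : ∀ φ ∈ equivariantOn ρ r x, ∀ c, η (φ c) = φ (η c) := fun φ hφ c =>
        Subtype.ext ((hφ h c (η c)).1 rfl)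
      have hηψ := hη ψ hψ
      -- D = ψ² on the whole class, so commuting with ψ suffices. Then η is determined by η y and is
      -- a power of ψ.
      have hηD : ∀ c, η (D c) = D (η c) := by
        have hψψ' : ∀ c, ψ (ψ c) = D c := by
          intro c
          rcases hcover c with rfl | rfl | rfl | rfl <;> simp only [hψD, hψψ]
        intro c
        rw [← hψψ', ← hψψ', hηψ, hηψ]
      have hcontra : η (η y) = D y → False := fun h2 => by
        refine hsq h y (congrArg Subtype.val h2) ?_
        have h3 : η (η (D y)) = y := by rw [hηD, hηD, h2, hDD]
        exact congrArg Subtype.val h3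
      have hηχ : η (χ a) = χ (η a) := by
        rcases hcover (η y) with h1 | h1 | h1 | h1
        · have : ∀ c, η c = c := by
            intro c
            rcases hcover c with rfl | rfl | rfl | rfl <;> simp only [hηD, hηψ, h1]
          rw [this, this]
        · exact (hcontra (by rw [h1, hηψ, h1, hψψ])).elim
        · have : ∀ c, η c = D c := by
            intro c
            rcases hcover c with rfl | rfl | rfl | rfl <;> simp only [hηD, hηψ, h1, hψD]
          rw [this, this, hχ]
        · exact (hcontra (by rw [h1, hηD, hηψ, h1, hψD, hψψ, hDD])).elim
      have hb : η a = b := Subtype.ext hab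
      rw [hb] at hηχ
      exact congrArg Subtype.val hηχ

end Equiv.Perm

/-! ### Compatibility of the actions with coordinatewise conjugacy -/

namespace GrothendieckTeichmuller

section

variable (G : Type*) [Group G]

/-- Coordinatewise conjugacy as an equivalence relation. -/
def coordConjSetoid : Setoid (TripleClass G) where
  r := CoordConj
  iseqv := ⟨CoordConj.refl, CoordConj.symm, CoordConj.trans⟩

theorem GT₁_eq_equivariant : GT₁ G = Equiv.Perm.equivariant (hAction G) (coordConjSetoid G) :=
  rfl

variable {G}

theorem isConj_map (a : MulAut G) {x y : G} (h : IsConj x y) : IsConj (a x) (a y) :=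
  a.toMonoidHom.map_isConj h

theorem isConj_inv_mul_mul {x y z w : G} (h : IsConj z w) :
    IsConj (x⁻¹ * z * x) (y⁻¹ * w * y) := by
  have key : ∀ u v : G, IsConj v (u⁻¹ * v * u) := fun u v => isConj_iff.2 ⟨u⁻¹, by simp⟩
  exact ((key x z).symm.trans h).trans (key y w)

theorem CoordConj.autAction (a : MulAut G) {c c' : TripleClass G} (h : CoordConj c c') :
    CoordConj (autAction G a c) (autAction G a c') := by
  induction c using Quotient.inductionOn with
  | h t =>
  induction c' using Quotient.inductionOn with
  | h t' => exact ⟨isConj_map a h.1, isConj_map a h.2.1, isConj_map a h.2.2⟩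

theorem CoordConj.theta {c c' : TripleClass G} (h : CoordConj c c') :
    CoordConj (theta G c) (theta G c') := by
  induction c using Quotient.inductionOn with
  | h t =>
  induction c' using Quotient.inductionOn with
  | h t' => exact ⟨h.2.1, h.1, isConj_inv_mul_mul h.2.2⟩

theorem CoordConj.delta {c c' : TripleClass G} (h : CoordConj c c') :
    CoordConj (delta G c) (delta G c') := by
  induction c using Quotient.inductionOn with
  | h t =>
  induction c' using Quotient.inductionOn with
  | h t' => exact ⟨h.2.2, h.2.1, isConj_inv_mul_mul h.1⟩

theorem CoordConj.symAction (σ : Equiv.Perm (Fin 3)) {c c' : TripleClass G} (h : CoordConj c c') :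
    CoordConj (symAction G σ c) (symAction G σ c') := by
  change CoordConj (symFun (GrothendieckTeichmuller.theta G) (GrothendieckTeichmuller.delta G) σ c)
    (symFun (GrothendieckTeichmuller.theta G) (GrothendieckTeichmuller.delta G) σ c')
  unfold symFun
  split_ifs
  · exact h
  · exact h.theta
  · exact h.delta
  · exact h.theta.delta.theta
  · exact h.delta.theta
  · exact h.theta.delta

theorem hAction_mk (a : MulAut G) (σ : Equiv.Perm (Fin 3)) :
    hAction G (QuotientGroup.mk a, σ) = autAction G a * symAction G σ := rfl

theorem hAction_mk_one (a : MulAut G) :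
    hAction G (QuotientGroup.mk a, 1) = autAction G a := by
  rw [hAction_mk, map_one, mul_one]

theorem CoordConj.hAction (h : Out G × Equiv.Perm (Fin 3)) {c c' : TripleClass G}
    (hc : CoordConj c c') : CoordConj (hAction G h c) (hAction G h c') := by
  obtain ⟨o, σ⟩ := h
  induction o using QuotientGroup.induction_on with
  | H a =>
    rw [hAction_mk]
    exact (hc.symAction σ).autAction a

/-- Two automorphisms that agree at one class of generating triples differ by an inner
automorphism. -/
theorem exists_conj_of_autAction_eq {a b : MulAut G} {c : TripleClass G}
    (h : autAction G a c = autAction G b c) : ∃ g : G, ∀ x, MulAut.conj g (a x) = b x := by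
  induction c using Quotient.inductionOn with
  | h t =>
    rw [autAction_mk, autAction_mk] at h
    obtain ⟨g, hg⟩ := Quotient.exact h
    refine ⟨g, fun x => ?_⟩
    have heq : Set.EqOn ((MulAut.conj g * a).toMonoidHom) b.toMonoidHom
        ({t.x, t.y, t.z} : Set G) := by
      rintro w (rfl | rfl | rfl)
      · exact congrArg Triple.x hg
      · exact congrArg Triple.y hg
      · exact congrArg Triple.z hg
    exact DFunLike.congr_fun (MonoidHom.eq_of_eqOn_dense t.closure_eq_top heq) x

/-- The sixth power of h = (a, σ) removes σ. By the hypotheses h² c = d c and h⁴ c = c, so h⁶ c = d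
c. The exponent is written 3 + 3 to exhibit a square. -/
theorem outAction_mk_pow_six {a : MulAut G} {σ : Equiv.Perm (Fin 3)} {d : MulAut G}
    {c : TripleClass G}
    (h₁ : hAction G (QuotientGroup.mk a, σ) (hAction G (QuotientGroup.mk a, σ) c) =
      autAction G d c)
    (h₂ : hAction G (QuotientGroup.mk a, σ) (hAction G (QuotientGroup.mk a, σ) (autAction G d c)) =
      c) : autAction G (a ^ 3 * a ^ 3) c = autAction G d c := by
  have hσ : σ ^ 6 = 1 := by
    simpa [Fintype.card_perm, Nat.factorial] using pow_card_eq_one (x := σ)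
  have h6 : hAction G ((QuotientGroup.mk a, σ) ^ 6) c = autAction G d c := by
    simp only [pow_succ, pow_zero, one_mul, map_mul, Equiv.Perm.mul_apply]
    rw [h₁, h₂, h₁]
  rw [Prod.pow_mk, hσ, ← QuotientGroup.mk_pow, hAction_mk_one] at h6
  rw [← pow_add]
  exact h6

end

end GrothendieckTeichmuller

/-! ### Finite fields and the conclusion -/

theorem FiniteField.isSquare_or_isSquare_mul_inv {F : Type*} [Field F] [Finite F] {ν : Fˣ}
    (hν : ¬ IsSquare (ν : F)) (a : F) : IsSquare a ∨ IsSquare (a * (ν⁻¹ : Fˣ)) := by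
  classical
  have := Fintype.ofFinite F
  by_cases ha : IsSquare a
  · exact Or.inl ha
  right
  have h1 := quadraticChar_neg_one_iff_not_isSquare.2 ha
  have h2 := quadraticChar_neg_one_iff_not_isSquare.2 hν
  have h3 : quadraticChar F (a * ν) = 1 := by rw [map_mul, h1, h2]; norm_num
  have h4 : IsSquare (a * ν) := by
    by_contra h
    rw [quadraticChar_neg_one_iff_not_isSquare.2 h] at h3
    norm_num at h3
  obtain ⟨e, he⟩ := h4
  refine ⟨e * (ν⁻¹ : Fˣ), ?_⟩
  rw [mul_mul_mul_comm, ← he, ← mul_assoc, Units.mul_inv_cancel_right]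

namespace Matrix.ProjectiveSpecialLinearGroup

open GrothendieckTeichmuller

variable {F : Type*} [Field F]

theorem GT₁_eq_bot [Finite F] (h2 : ringChar F = 2) :
    GT₁ (ProjectiveSpecialLinearGroup (Fin 2) F) = ⊥ := by
  rw [eq_bot_iff]
  intro φ hφ
  rw [Subgroup.mem_bot]
  ext c
  refine (eq_of_coordConj (F := F) ?_ (FiniteField.isSquare_of_char_two h2) (hφ.2 c)).symm
  have := ringChar.Nat.cast_ringChar (R := F)
  rw [h2] at this
  exact_mod_cast this

theorem autAction_diagAut_diagAut (ν : Fˣ)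
    (c : TripleClass (ProjectiveSpecialLinearGroup (Fin 2) F)) :
    autAction _ (diagAut ν) (autAction _ (diagAut ν) c) = c := by
  induction c using Quotient.inductionOn with
  | h t =>
    rw [autAction_mk, autAction_mk]
    have h : MulAut.conj (proj (SpecialLinearGroup.torus ν)) • t = diagAut ν • diagAut ν • t := by
      refine Triple.ext_of_xy ?_ ?_
      · rw [smul_x, smul_x, smul_x, diagAut_diagAut]
      · rw [smul_y, smul_y, smul_y, diagAut_diagAut]
    rw [← h]
    exact (Quotient.sound ⟨_, rfl⟩ : (⟦t⟧ : TripleClass _) = _).symm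

theorem exists_GT₁_mulEquiv [Finite F] {p : ℕ} [Fact p.Prime] [CharP F p] (hp : Odd p) :
    ∃ n₁ n₂ : ℕ, Nonempty (GT₁ (ProjectiveSpecialLinearGroup (Fin 2) F) ≃*
      (Fin n₁ → Multiplicative (ZMod 2)) × (Fin n₂ → DihedralGroup 4)) := by
  have hp2 : ringChar F ≠ 2 := by
    rw [ringChar.eq F p]
    rintro rfl
    exact absurd hp (by decide)
  obtain ⟨n, hn⟩ := FiniteField.exists_nonsquare hp2
  have hn0 : n ≠ 0 := by rintro rfl; exact hn (IsSquare.zero)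
  obtain ⟨ν, rfl⟩ : ∃ ν : Fˣ, (ν : F) = n := ⟨Units.mk0 n hn0, rfl⟩
  have hν := FiniteField.isSquare_or_isSquare_mul_inv hn
  let G := ProjectiveSpecialLinearGroup (Fin 2) F
  have : Finite (Triple G) := Finite.of_injective (fun t => (t.x, t.y)) fun t t' h =>
    Triple.ext_of_xy (congrArg Prod.fst h) (congrArg Prod.snd h)
  let d : Out G × Equiv.Perm (Fin 3) := (QuotientGroup.mk (diagAut ν), 1)
  have hd : hAction G d = autAction G (diagAut ν) := hAction_mk_one _
  have hr : ∀ h x y, coordConjSetoid G x y → coordConjSetoid G (hAction G h x) (hAction G h y) :=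
    fun h _ _ hxy => CoordConj.hAction h hxy
  rw [GT₁_eq_equivariant]
  refine Equiv.Perm.exists_equivariant_mulEquiv hr
    (Equiv.Perm.equivariantOn_dichotomy hr d ?_ ?_ ?_ ?_)
  · intro c hc
    rw [hd] at hc
    obtain ⟨g, hg⟩ := exists_conj_of_autAction_eq (a := 1) (b := diagAut ν) (c := c)
      (by rw [hc, map_one, Equiv.Perm.one_apply])
    -- A fixed point would make the diagonal automorphism inner, that is, the square of the identity
    -- modulo inner automorphisms.
    exact not_square_diagAut hp hν hn 1 g hg
  · intro c
    rw [hd]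
    exact autAction_diagAut_diagAut ν c
  · intro c₁ c₂ c₃ h₂ h₃
    rw [hd]
    exact eq_or_of_coordConj hν h₂ h₃
  · rintro ⟨o, σ⟩ c h₁ h₂
    induction o using QuotientGroup.induction_on with
    | H a =>
      rw [hd] at h₁ h₂
      obtain ⟨g, hg⟩ := exists_conj_of_autAction_eq (outAction_mk_pow_six h₁ h₂)
      exact not_square_diagAut hp hν hn (a ^ 3) g fun x => by
        rw [← MulAut.mul_apply]
        exact hg x

end Matrix.ProjectiveSpecialLinearGroup

theorem theorem1 (F : Type u) [Field F] [Finite F] (q : ℕ) (hq : Nat.card F = q) :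
    ((∃ s : ℕ, 1 ≤ s ∧ q = 2 ^ s) →
      GrothendieckTeichmuller.GT₁ (Matrix.ProjectiveSpecialLinearGroup (Fin 2) F) = ⊥) ∧
    (Odd q →
      ∃ n₁ n₂ : ℕ,
        Nonempty (GrothendieckTeichmuller.GT₁ (Matrix.ProjectiveSpecialLinearGroup (Fin 2) F) ≃*
          (Fin n₁ → Multiplicative (ZMod 2)) × (Fin n₂ → DihedralGroup 4))) := by
  have := Fintype.ofFinite F
  obtain ⟨p, hchar⟩ := CharP.exists F
  obtain ⟨n, hp, hcard⟩ := FiniteField.card F p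
  have : Fact p.Prime := ⟨hp⟩
  rw [Nat.card_eq_fintype_card, hcard] at hq
  refine ⟨fun ⟨s, hs, hqs⟩ => ?_, fun hodd => ?_⟩
  · apply Matrix.ProjectiveSpecialLinearGroup.GT₁_eq_bot
    rw [ringChar.eq F p]
    have h1 : p ∣ 2 ^ s := by
      rw [← hqs, ← hq]
      exact dvd_pow_self p n.ne_zero
    exact (Nat.prime_dvd_prime_iff_eq hp Nat.prime_two).1 (hp.dvd_of_dvd_pow h1)
  · apply Matrix.ProjectiveSpecialLinearGroup.exists_GT₁_mulEquiv (p := p)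
    rw [← hq] at hodd
    exact (Nat.odd_pow_iff n.ne_zero).1 hodd
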